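/- Let $V=\{1,\dots,n\}$ and let $c_{xy}=c_{yx}\ge 0$ ($x\ne y$) be weights on the edge set $E$ of the complete graph on $V$; call this weighted graph $G$, and assume that the graph formed by the edges with $c_{xy}>0$ is connected. For a symmetric Markov generator $\mathcal L$ on a finite state space with at least two states, let $\lambda_1$ (the spectral gap) be the second entry of the list $\lambda_0\le\lambda_1\le\dots$ of the eigenvalues of $-\mathcal L$, repeated according to multiplicity. A chain with generator $\mathcal L_2$ on $S_2$ is a *sub-process* of a chain with generator $\mathcal L_1$ on $S_1$ via $\pi$ if $\pi:S_1\to S_2$ is surjective and $\mathcal L_1(f\circ\pi)=(\mathcal L_2f)\circ\pi$ for all $f:S_2\to\mathbb R$. The *random walk* has state space $V$ and generator $\mathcal L^{RW}f(x)=\sum_{y\neq x}c_{xy}(f(y)-f(x))$. The other chains have a generator of the form $\mathcal Lf(s)=\sum_{xy\in E}c_{xy}(f(s^{xy})-f(s))$, where: * *Interchange process (IP):* the states are the permutations $\eta$ of $V$, where $\eta$ maps each vertex to the label of the particle on it, and $\eta^{xy}=\eta\tau_{xy}$ with $\tau_{xy}$ the transposition of $x$ and $y$. Write $\xi_i(\eta)=\eta^{-1}(i)$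 for the position of particle $i$. * *Cycle process (CP), $n\ge4$:* the states are the $n$-cycles of the complete graph, i.e. the sets $\gamma\subset E$ that form a graph isomorphic to the cycle of length $n$, and $\gamma^{xy}$ is obtained by exchanging $x$ and $y$ in every edge of $\gamma$. * *Matching process (MP), $n=2k$, $k\ge2$:* the states are the perfect matchings of $V$, i.e. the sets $\zeta\subset E$ of $k$ pairwise disjoint edges, and $\zeta^{xy}$ is obtained by exchanging $x$ and $y$ in every edge of $\zeta$ (so $\zeta^{xy}=\zeta$ if $xy\in\zeta$, and otherwise the edges $xu,yv\in\zeta$ are replaced by $yu,xv$). Then: 1. If $n\ge4$, the cycle process is a sub-process of the interchange process via $\pi(\eta)=\{\xi_1(\eta)\xi_2(\eta),\dots,\xi_{n-1}(\eta)\xi_n(\eta),\xi_n(\eta)\xi_1(\eta)\}$, and $\lambda_1^{CP}(G)\ge\lambda_1^{RW}(G)$. 2. If $n=2k$ with $k\ge2$, the matching process is a sub-process of the interchange process via $\pi(\eta)=\{\xi_1(\eta)\xi_{k+1}(\eta),\dots,\xi_k(\eta)\xi_{2k}(\eta)\}$, and $\lambda_1^{MP}(G)\ge\lambda_1^{RW}(G)$.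 -/

import Mathlib

open Finset

noncomputable section

namespace AldousGap

/-! ### Generators, sub-processes and spectral gaps -/

/-- Linear operators on real-valued functions on a state space `S`
(the generators of Markov chains are of this kind). -/
abbrev Operator (S : Type) : Type := (S → ℝ) →ₗ[ℝ] (S → ℝ)

/-- The chain with generator `L₂` is a sub-process of the chain with generator `L₁`, by means of
the contraction `π`: the map `π` is onto, and `L₁ (f ∘ π) = (L₂ f) ∘ π` for all `f : S₂ → ℝ`. -/
def IsSubprocessVia {S₁ S₂ : Type} (L₂ : Operator S₂) (L₁ : Operator S₁) (π : S₁ → S₂) : Prop :=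
  Function.Surjective π ∧ ∀ f : S₂ → ℝ, L₁ (f ∘ π) = (L₂ f) ∘ π

/-- The real eigenvalues `λ₀ ≤ λ₁ ≤ …` of an operator in increasing order, each repeated
according to its (algebraic) multiplicity. -/
def eigenvalueList {S : Type} [Finite S] (A : Operator S) : List ℝ :=
  (LinearMap.charpoly A).roots.sort (· ≤ ·)

/-- The spectral gap of the chain with generator `L`: the entry `λ₁` in the increasing list
`λ₀ ≤ λ₁ ≤ …` of the eigenvalues of `-L`. The default value `0` is never used for a
symmetric generator on at least two states. -/
def spectralGap {S : Type} [Finite S] (L : Operator S) : ℝ :=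
  (eigenvalueList (-L)).getD 1 0

/-! ### Weighted graphs, random walk and interchange process -/

/-- Edge weights on the complete graph with vertex set `Fin n`.
Values on the diagonal play no role. -/
structure WeightedGraph (n : ℕ) where
  weight : Fin n → Fin n → ℝ
  symm : ∀ x y, weight x y = weight y x
  nonneg : ∀ x y, x ≠ y → 0 ≤ weight x y

/-- The graph formed by the edges of positive weight. -/
def WeightedGraph.skeleton {n : ℕ} (G : WeightedGraph n) : SimpleGraph (Fin n) where
  Adj x y := x ≠ y ∧ 0 < G.weight x y
  symm := ⟨fun x y h => ⟨h.1.symm, by rw [G.symm y x]; exact h.2⟩⟩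
  loopless := ⟨fun _ h => h.1 rfl⟩

/-- The generator `f ↦ (s ↦ ∑_{xy ∈ E} c_{xy} (f (s^{xy}) - f s))`, for a given map
`act x y s = s^{xy}`. Each edge `{x, y}` is listed once, with `x < y`. -/
def edgeGenerator {n : ℕ} (G : WeightedGraph n) {S : Type}
    (act : Fin n → Fin n → S → S) : Operator S where
  toFun f s := ∑ p : Fin n × Fin n with p.1 < p.2,
    G.weight p.1 p.2 * (f (act p.1 p.2 s) - f s)
  map_add' f g := by
    funext s
    simp only [Pi.add_apply, ← Finset.sum_add_distrib]
    exact Finset.sum_congr rfl fun p _ => by ring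
  map_smul' a f := by
    funext s
    simp only [Pi.smul_apply, smul_eq_mul, RingHom.id_apply, Finset.mul_sum]
    exact Finset.sum_congr rfl fun p _ => by ring

/-- The generator of the random walk. -/
def randomWalk {n : ℕ} (G : WeightedGraph n) : Operator (Fin n) where
  toFun f x := ∑ y : Fin n with y ≠ x, G.weight x y * (f y - f x)
  map_add' f g := by
    funext s
    simp only [Pi.add_apply, ← Finset.sum_add_distrib]
    exact Finset.sum_congr rfl fun p _ => by ring
  map_smul' a f := by
    funext s
    simp only [Pi.smul_apply, smul_eq_mul, RingHom.id_apply, Finset.mul_sum]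
    exact Finset.sum_congr rfl fun p _ => by ring

/-- The generator of the interchange process. A state `η` sends a vertex to the label of the
particle sitting there, and `η^{xy} = η τ_{xy}`. -/
def interchange {n : ℕ} (G : WeightedGraph n) : Operator (Equiv.Perm (Fin n)) :=
  edgeGenerator G fun x y η => η * Equiv.swap x y

/-- The position `ξ_i(η)` of the particle labelled `i`. -/
def position {n : ℕ} (η : Equiv.Perm (Fin n)) (i : Fin n) : Fin n := η⁻¹ i

/-- The effect of a vertex permutation on a set of edges: `{σ b : b ∈ γ}`. -/
def mapEdges {n : ℕ} (σ : Equiv.Perm (Fin n)) (γ : Finset (Sym2 (Fin n))) :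
    Finset (Sym2 (Fin n)) :=
  γ.image (Sym2.map σ)

theorem map_mem_mapEdges {n : ℕ} (σ : Equiv.Perm (Fin n)) (γ : Finset (Sym2 (Fin n)))
    (e : Sym2 (Fin n)) : Sym2.map σ e ∈ mapEdges σ γ ↔ e ∈ γ := by
  unfold mapEdges
  rw [Finset.mem_image]
  constructor
  · rintro ⟨a, ha, hae⟩
    rwa [← Sym2.map.injective σ.injective hae]
  · exact fun h => ⟨e, h, rfl⟩

/-! ### The cycle process -/

/-- `γ` is an `n`-cycle: a set of edges of the complete graph on `Fin n` forming a graph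
isomorphic to the cycle of length `n`. -/
def IsNCycle {n : ℕ} (γ : Finset (Sym2 (Fin n))) : Prop :=
  (∀ e ∈ γ, ¬ e.IsDiag) ∧
    Nonempty (SimpleGraph.fromEdgeSet (γ : Set (Sym2 (Fin n))) ≃g SimpleGraph.cycleGraph n)

/-- The state space of the cycle process. -/
abbrev CycleState (n : ℕ) : Type := {γ : Finset (Sym2 (Fin n)) // IsNCycle γ}

theorem not_isDiag_mapEdges {n : ℕ} (σ : Equiv.Perm (Fin n)) {γ : Finset (Sym2 (Fin n))}
    (h : ∀ e ∈ γ, ¬ e.IsDiag) : ∀ e ∈ mapEdges σ γ, ¬ e.IsDiag := by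
  intro e he
  obtain ⟨a, ha, rfl⟩ := Finset.mem_image.mp he
  rw [Sym2.isDiag_map σ.injective]
  exact h a ha

theorem isNCycle_mapEdges {n : ℕ} (σ : Equiv.Perm (Fin n)) {γ : Finset (Sym2 (Fin n))}
    (h : IsNCycle γ) : IsNCycle (mapEdges σ γ) := by
  obtain ⟨h1, ⟨φ⟩⟩ := h
  let ψ : SimpleGraph.fromEdgeSet (γ : Set (Sym2 (Fin n))) ≃g
      SimpleGraph.fromEdgeSet (mapEdges σ γ : Set (Sym2 (Fin n))) := ⟨σ, ?_⟩
  · exact ⟨not_isDiag_mapEdges σ h1, ⟨ψ.symm.trans φ⟩⟩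
  intro a b
  have := map_mem_mapEdges σ γ s(a, b)
  simp only [Sym2.map_mk] at this
  simp [SimpleGraph.fromEdgeSet_adj, this]

/-- `γ^{xy}`: the vertices `x` and `y` are exchanged in every edge of `γ`, so that an edge
`yz` becomes `xz`, an edge `xz` becomes `yz` (for `z ≠ x, y`), and all other edges stay. -/
def cycleMove {n : ℕ} (x y : Fin n) (γ : CycleState n) : CycleState n :=
  ⟨mapEdges (Equiv.swap x y) γ.1, isNCycle_mapEdges _ γ.2⟩

/-- The generator of the cycle process. -/
def cycleProcess {n : ℕ} (G : WeightedGraph n) : Operator (CycleState n) :=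
  edgeGenerator G cycleMove

/-- The standard cycle with edges `{i, i + 1}`, indices modulo `n`. -/
def standardCycle (n : ℕ) : Finset (Sym2 (Fin n)) :=
  univ.image fun i : Fin n => s(i, finRotate n i)

theorem isNCycle_standardCycle {n : ℕ} (hn : 4 ≤ n) : IsNCycle (standardCycle n) := by
  obtain ⟨m, rfl⟩ : ∃ m, n = m + 2 := ⟨n - 2, by omega⟩
  have hne : ∀ i : Fin (m + 2), i + 1 ≠ i := fun i h => by simp at h
  refine ⟨?_, ⟨⟨Equiv.refl _, ?_⟩⟩⟩
  · intro e he
    obtain ⟨i, -, rfl⟩ := Finset.mem_image.mp he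
    simp
  · intro a b
    simp only [Equiv.refl_apply, SimpleGraph.cycleGraph_adj, SimpleGraph.fromEdgeSet_adj,
      standardCycle, Finset.coe_image, Finset.coe_univ, Set.image_univ, Set.mem_range,
      finRotate_apply, Sym2.eq_iff]
    constructor
    · rintro (h | h)
      · have : a = b + 1 := by rw [← h]; abel
        subst this
        exact ⟨⟨b, Or.inr ⟨rfl, rfl⟩⟩, hne b⟩
      · have : b = a + 1 := by rw [← h]; abel
        subst this
        exact ⟨⟨a, Or.inl ⟨rfl, rfl⟩⟩, (hne a).symm⟩
    · rintro ⟨⟨i, (⟨rfl, rfl⟩ | ⟨rfl, rfl⟩)⟩, -⟩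
      · right; abel
      · left; abel

/-- The contraction `η ↦ {ξ₁ξ₂, …, ξ_{n-1}ξ_n, ξ_nξ₁}` from the interchange process to the
cycle process: the standard cycle is pinned to the particles, in the order of their labels. -/
def cycleProjection {n : ℕ} (hn : 4 ≤ n) (η : Equiv.Perm (Fin n)) : CycleState n :=
  ⟨univ.image fun i : Fin n => s(position η i, position η (finRotate n i)), by
    have h := isNCycle_mapEdges η⁻¹ (isNCycle_standardCycle hn)
    rw [mapEdges, standardCycle, Finset.image_image] at h
    exact h⟩

/-! ### The matching process -/

/-- `ζ` is a perfect matching of `Fin (2 * k)`: a set of `k` edges, no two of which share a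
vertex. -/
def IsMatchingConfig {k : ℕ} (ζ : Finset (Sym2 (Fin (2 * k)))) : Prop :=
  (∀ e ∈ ζ, ¬ e.IsDiag) ∧ ζ.card = k ∧
    ∀ e ∈ ζ, ∀ e' ∈ ζ, e ≠ e' → ∀ v, v ∈ e → v ∉ e'

/-- The state space of the matching process. -/
abbrev MatchingState (k : ℕ) : Type := {ζ : Finset (Sym2 (Fin (2 * k))) // IsMatchingConfig ζ}

theorem isMatchingConfig_mapEdges {k : ℕ} (σ : Equiv.Perm (Fin (2 * k)))
    {ζ : Finset (Sym2 (Fin (2 * k)))} (h : IsMatchingConfig ζ) :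
    IsMatchingConfig (mapEdges σ ζ) := by
  obtain ⟨h1, h2, h3⟩ := h
  refine ⟨not_isDiag_mapEdges σ h1, ?_, ?_⟩
  · rw [mapEdges, Finset.card_image_of_injective _ (Sym2.map.injective σ.injective), h2]
  · intro e he e' he' hne v hv hv'
    obtain ⟨a, ha, rfl⟩ := Finset.mem_image.mp he
    obtain ⟨b, hb, rfl⟩ := Finset.mem_image.mp he'
    obtain ⟨u, hu, rfl⟩ := Sym2.mem_map.mp hv
    obtain ⟨w, hw, hwu⟩ := Sym2.mem_map.mp hv'
    rw [σ.injective hwu] at hw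
    exact h3 a ha b hb (fun hab => hne (by rw [hab])) u hu hw

/-- `ζ^{xy}`: the vertices `x` and `y` are exchanged in every edge of `ζ`. Nothing happens if
`xy ∈ ζ`; otherwise the edges `xu, yv ∈ ζ` are replaced by `yu, xv`. -/
def matchingMove {k : ℕ} (x y : Fin (2 * k)) (ζ : MatchingState k) : MatchingState k :=
  ⟨mapEdges (Equiv.swap x y) ζ.1, isMatchingConfig_mapEdges _ ζ.2⟩

/-- The generator of the matching process. -/
def matchingProcess {k : ℕ} (G : WeightedGraph (2 * k)) : Operator (MatchingState k) :=
  edgeGenerator G matchingMove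

/-- The label `i`, for `i` among the first `k` of the `2k` labels. -/
def lowLabel {k : ℕ} (i : Fin k) : Fin (2 * k) := ⟨i, by omega⟩

/-- The label `k + i`. -/
def highLabel {k : ℕ} (i : Fin k) : Fin (2 * k) := ⟨k + i, by omega⟩

/-- The contraction `η ↦ {ξ₁ξ_{k+1}, …, ξ_kξ_{2k}}` from the interchange process to the
matching process. -/
def matchingProjection {k : ℕ} (η : Equiv.Perm (Fin (2 * k))) : MatchingState k :=
  ⟨univ.image fun i : Fin k => s(position η (lowLabel i), position η (highLabel i)), by
    have hlh : ∀ i j : Fin k, lowLabel i ≠ highLabel j := fun i j h => by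
      have := congrArg Fin.val h
      simp only [lowLabel, highLabel] at this
      omega
    have hl : ∀ i j : Fin k, lowLabel i = lowLabel j → i = j := fun i j h => by
      have := congrArg Fin.val h
      exact Fin.ext this
    have hh : ∀ i j : Fin k, highLabel i = highLabel j → i = j := fun i j h => by
      have := congrArg Fin.val h
      simp only [highLabel] at this
      exact Fin.ext (by omega)
    have key : ∀ i j : Fin k, ∀ v, v ∈ s(position η (lowLabel i), position η (highLabel i)) →
        v ∈ s(position η (lowLabel j), position η (highLabel j)) → i = j := by
      intro i j v hi hj
      rw [Sym2.mem_iff] at hi hj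
      unfold position at hi hj
      rcases hi with rfl | rfl <;> rcases hj with hj | hj
      · exact hl _ _ (η⁻¹.injective hj)
      · exact absurd (η⁻¹.injective hj) (hlh _ _)
      · exact absurd (η⁻¹.injective hj).symm (hlh _ _)
      · exact hh _ _ (η⁻¹.injective hj)
    refine ⟨?_, ?_, ?_⟩
    · intro e he
      obtain ⟨i, -, rfl⟩ := Finset.mem_image.mp he
      rw [Sym2.mk_isDiag_iff]
      exact fun h => hlh i i (η⁻¹.injective h)
    · rw [Finset.card_image_of_injective, Finset.card_univ, Fintype.card_fin]
      intro i j hij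
      refine key i j _ (Sym2.mem_mk_left _ _) ?_
      dsimp only at hij
      rw [← hij]
      exact Sym2.mem_mk_left _ _
    · intro e he e' he' hne v hv hv'
      obtain ⟨i, -, rfl⟩ := Finset.mem_image.mp he
      obtain ⟨j, -, rfl⟩ := Finset.mem_image.mp he'
      exact hne (by rw [key i j v hv hv'])⟩

end AldousGap

end

/-! Both projections have the form η ↦ η⁻¹γ₀ for a fixed edge set γ₀, so they turn right
multiplication by a transposition into the exchange of two vertices. Eigenfunctions of a sub-process
pull back to the interchange process with the same eigenvalue, so the bounds follow from Aldous'
spectral gap inequality, `interchange_form_ge`, phrased as the transfer of a Poincaré inequality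
from the random walk.

That inequality is proved by induction on the number of vertices. Summing an eigenfunction over the
states with particle i at x gives a function of x that vanishes or is a random walk eigenfunction
with the same eigenvalue. If all these marginals vanish, the restriction to the states with a given
particle at vertex 0 has sum zero, and the induction hypothesis applies to the electrical network
with vertex 0 eliminated. Elimination preserves the Poincaré constant of the random walk
(`randomWalk_reduce_form_ge`) and does not increase the interchange energy
(`sum_interchange_reduce_le`).

The last comparison is the octopus inequality: Q = ∑ b_x b_y (τ_xy + 1 - τ_ox - τ_oy) is positive
semidefinite. For x ≠ y a single summand is not, but the symmetrised quartic expression T =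
`octopusTerm` is symmetric with T² = 24T, hence positive. Its weighted sum is 6(2cQ - Q²) with c ≥
0, so 2cQ ≥ Q² ≥ 0. The identity T² = 24T involves at most five points and is verified by integer
computation with permutations of them. -/

namespace AldousGap

/-! ### Symmetric operators on finite state spaces -/

section Spectral

variable {S : Type} [Fintype S]

/-- Symmetry of an operator for the counting measure. -/
def SymmetricOp (A : Operator S) : Prop :=
  ∀ f g : S → ℝ, ∑ s, A f s * g s = ∑ s, f s * A g s

theorem SymmetricOp.neg {A : Operator S} (h : SymmetricOp A) : SymmetricOp (-A) := by
  intro f g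
  simpa using congrArg Neg.neg (h f g)

/-- The spectral theorem: an orthonormal basis of eigenfunctions, whose eigenvalues are the roots
of the characteristic polynomial. -/
theorem SymmetricOp.exists_eigenbasis {A : Operator S} (h : SymmetricOp A) :
    ∃ (v : S → S → ℝ) (a : S → ℝ), (∀ i, A (v i) = a i • v i) ∧
      (∀ i, ∑ s, v i s * v i s = 1) ∧
      (∀ f g : S → ℝ, ∑ s, f s * g s = ∑ i, (∑ s, f s * v i s) * (∑ s, g s * v i s)) ∧
      (∀ i j, i ≠ j → ∑ s, v i s * v j s = 0) ∧
      (LinearMap.charpoly A).roots = univ.val.map a := by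
  classical
  have hM : (LinearMap.toMatrix' A).IsHermitian := by
    ext i j
    have := h (Pi.single i 1) (Pi.single j 1)
    simp [Pi.single_apply] at this
    simpa [Matrix.conjTranspose_apply, LinearMap.toMatrix'_apply] using this
  have inner_eq : ∀ f g : EuclideanSpace ℝ S, inner ℝ f g = ∑ s, f s * g s := by
    intro f g
    simp [PiLp.inner_apply, mul_comm]
  refine ⟨fun i => (hM.eigenvectorBasis i).ofLp, hM.eigenvalues, ?_, ?_, ?_, ?_, ?_⟩
  · intro i
    rw [← hM.mulVec_eigenvectorBasis i, LinearMap.toMatrix'_mulVec]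
  · intro i
    have := hM.eigenvectorBasis.orthonormal.1 i
    rw [← inner_eq, real_inner_self_eq_norm_sq, this, one_pow]
  · intro f g
    have := hM.eigenvectorBasis.sum_inner_mul_inner (WithLp.toLp 2 f) (WithLp.toLp 2 g)
    simp only [inner_eq] at this
    rw [← this]
    exact Finset.sum_congr rfl fun i _ => by
      congr 1
      exact Finset.sum_congr rfl fun s _ => mul_comm _ _
  · intro i j hij
    rw [← inner_eq]
    exact hM.eigenvectorBasis.orthonormal.2 hij
  · rw [← LinearMap.charpoly_toMatrix A (Pi.basisFun ℝ S), LinearMap.toMatrix_eq_toMatrix',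
      hM.roots_charpoly_eq_eigenvalues]
    rfl

theorem SymmetricOp.sum_mul_apply_eq {A : Operator S} (h : SymmetricOp A) {v : S → S → ℝ}
    {a : S → ℝ} (hv : ∀ i, A (v i) = a i • v i)
    (hp : ∀ f g : S → ℝ, ∑ s, f s * g s = ∑ i, (∑ s, f s * v i s) * (∑ s, g s * v i s))
    (f g : S → ℝ) :
    ∑ s, A f s * g s = ∑ i, a i * ((∑ s, f s * v i s) * (∑ s, g s * v i s)) := by
  rw [hp]
  refine Finset.sum_congr rfl fun i _ => ?_
  rw [h f (v i), hv i]
  simp only [Pi.smul_apply, smul_eq_mul, mul_left_comm _ (a i), ← Finset.mul_sum]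
  ring

/-- If the operator kills constants, the mean of an eigenfunction can be removed. -/
theorem SymmetricOp.apply_sub_mean {A : Operator S} (h : SymmetricOp A)
    (h1 : A (fun _ => 1) = 0) {f : S → ℝ} {μ : ℝ} (hf : A f = μ • f) :
    A (fun s => f s - (∑ r, f r) / Fintype.card S) =
      μ • (fun s => f s - (∑ r, f r) / Fintype.card S) := by
  set m := (∑ r, f r) / Fintype.card S with hm
  -- Symmetry tested against the constant 1: either the mean is already zero, or μ = 0 and the
  -- constants share the eigenvalue.
  have hμ : μ * m = 0 := by
    have := h f (fun _ => 1)
    rw [hf, h1] at this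
    simp only [Pi.smul_apply, smul_eq_mul, mul_one, Pi.zero_apply, mul_zero,
      Finset.sum_const_zero, ← Finset.mul_sum] at this
    rw [hm, ← mul_div_assoc, this, zero_div]
  have e : (fun s => f s - m) = f - m • (fun _ : S => (1 : ℝ)) := by
    funext s
    simp
  rw [e, map_sub, map_smul, h1, hf, smul_sub, smul_smul, hμ]
  simp

theorem sum_sub_mean [Nonempty S] (f : S → ℝ) :
    ∑ s, (f s - (∑ r, f r) / Fintype.card S) = 0 := by
  rw [Finset.sum_sub_distrib, Finset.sum_const, Finset.card_univ, nsmul_eq_mul,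
    mul_div_cancel₀ _ (by positivity), sub_self]

/-- A lower bound on all eigenvalues on mean-zero functions bounds the quadratic form there. -/
theorem SymmetricOp.form_ge_of_eigenvalue_ge {A : Operator S} (h : SymmetricOp A)
    (h1 : A (fun _ => 1) = 0) {t : ℝ}
    (ht : ∀ (f : S → ℝ) (μ : ℝ), f ≠ 0 → ∑ s, f s = 0 → A f = μ • f → t ≤ μ)
    (f : S → ℝ) (hf : ∑ s, f s = 0) : t * ∑ s, f s * f s ≤ ∑ s, A f s * f s := by
  rcases isEmpty_or_nonempty S with hS | hS
  · simp
  obtain ⟨v, a, hv, -, hp, -, -⟩ := h.exists_eigenbasis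
  rw [h.sum_mul_apply_eq hv hp, hp f f, Finset.mul_sum]
  refine Finset.sum_le_sum fun i _ => ?_
  -- A constant `v i` is orthogonal to `f`. Otherwise its mean-free part is nonzero with the same
  -- eigenvalue, and `ht` applies.
  by_cases hc : (fun s => v i s - (∑ r, v i r) / Fintype.card S) = 0
  · have : ∑ s, f s * v i s = 0 := by
      have hvi : ∀ s, v i s = (∑ r, v i r) / Fintype.card S := fun s =>
        sub_eq_zero.mp (congrFun hc s)
      rw [Finset.sum_congr rfl fun s _ => by rw [hvi s], ← Finset.sum_mul, hf, zero_mul]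
    simp [this]
  · exact mul_le_mul_of_nonneg_right
      (ht _ (a i) hc (sum_sub_mean _) (h.apply_sub_mean h1 (hv i))) (mul_self_nonneg _)

/-- The entry λ₁ is accessed through the number of entries below a threshold, which can be counted
on the unsorted family of eigenvalues. -/
theorem getElem_one_le_of_countP {l : List ℝ} (hl : l.Pairwise (· ≤ ·)) (h2 : 2 ≤ l.length)
    (t : ℝ) (hc : l.countP (fun x => decide (x < t)) ≤ 1) : t ≤ l[1] := by
  match l, hl, h2, hc with
  | x :: y :: l, hl, _, hc =>
    simp only [List.pairwise_cons, List.mem_cons, forall_eq_or_imp] at hl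
    by_contra hlt
    have hy : y < t := by simpa using hlt
    have hx : x < t := hl.1.1.trans_lt hy
    simp [hx, hy] at hc

theorem countP_lt_getElem_one_le {l : List ℝ} (hl : l.Pairwise (· ≤ ·)) (h2 : 2 ≤ l.length) :
    l.countP (fun x => decide (x < l[1])) ≤ 1 := by
  match l, hl, h2 with
  | x :: y :: l, hl, _ =>
    simp only [List.pairwise_cons, List.mem_cons, forall_eq_or_imp] at hl
    have : l.countP (fun z => decide (z < y)) = 0 := by
      rw [List.countP_eq_zero]
      intro z hz
      simpa using hl.2.1 z hz
    simp only [List.getElem_cons_succ, List.getElem_cons_zero, List.countP_cons, this,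
      lt_self_iff_false, decide_false]
    simp only [Bool.false_eq_true, if_false, zero_add]
    split <;> simp

theorem countP_sort_map (a : S → ℝ) (t : ℝ) :
    ((univ.val.map a).sort (· ≤ ·)).countP (fun x => decide (x < t)) = #{i | a i < t} := by
  rw [← Multiset.coe_countP (p := fun x => x < t), Multiset.sort_eq, Multiset.countP_map]
  rfl

theorem length_sort_map (a : S → ℝ) :
    ((univ.val.map a).sort (· ≤ ·)).length = Fintype.card S := by
  simp [Finset.card_univ]

/-- Lower bound for the spectral gap from a lower bound for nonconstant eigenfunctions. -/
theorem le_spectralGap {L : Operator S} (h : SymmetricOp L) (h2 : 2 ≤ Fintype.card S) {t : ℝ}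
    (ht : ∀ (f : S → ℝ) (μ : ℝ), (∃ r s, f r ≠ f s) → (-L) f = μ • f → t ≤ μ) :
    t ≤ spectralGap L := by
  obtain ⟨v, a, hv, hn, hp, ho, hr⟩ := h.neg.exists_eigenbasis
  have hlen : 2 ≤ ((univ.val.map a).sort (· ≤ ·)).length := by rwa [length_sort_map]
  unfold spectralGap eigenvalueList
  rw [hr, List.getD_eq_getElem _ _ (by omega)]
  refine getElem_one_le_of_countP (Multiset.pairwise_sort _ _) hlen t ?_
  rw [countP_sort_map, Finset.card_le_one]
  intro i hi j hj
  rw [Finset.mem_filter] at hi hj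
  have hconst : ∀ i, a i < t → ∀ r s, v i r = v i s := by
    intro i hi r s
    by_contra hne
    exact absurd (ht _ _ ⟨r, s, hne⟩ (hv i)) (not_le.mpr hi)
  by_contra hij
  have hi' := hn i
  have hj' := hn j
  have hij' := ho i j hij
  rw [Finset.sum_congr rfl fun s _ => by rw [hconst i hi.2 s i]] at hi'
  rw [Finset.sum_congr rfl fun s _ => by rw [hconst j hj.2 s i]] at hj'
  rw [Finset.sum_congr rfl fun s _ => by rw [hconst i hi.2 s i, hconst j hj.2 s i]] at hij'
  simp only [Finset.sum_const, nsmul_eq_mul] at hi' hj' hij'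
  -- With N states and constant values α, β, this is the clash between Nα² = 1, Nβ² = 1 and Nαβ = 0.
  have : (1 : ℝ) = 0 := by
    linear_combination (-(#(univ : Finset S) : ℝ) * (v j i * v j i)) * hi' - hj' +
      (#(univ : Finset S) : ℝ) * (v i i * v j i) * hij'
  exact one_ne_zero this

/-- The variational lower bound given by the spectral gap. -/
theorem spectralGap_mul_le {L : Operator S} (h : SymmetricOp L) (h2 : 2 ≤ Fintype.card S)
    (h1 : L (fun _ => 1) = 0) (hpos : ∀ f : S → ℝ, 0 ≤ ∑ s, (-L) f s * f s)
    (f : S → ℝ) (hf : ∑ s, f s = 0) :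
    spectralGap L * ∑ s, f s * f s ≤ ∑ s, (-L) f s * f s := by
  obtain ⟨v, a, hv, hn, hp, ho, hr⟩ := h.neg.exists_eigenbasis
  have hlen : 2 ≤ ((univ.val.map a).sort (· ≤ ·)).length := by rwa [length_sort_map]
  set gap := spectralGap L with hgap
  have hcount : #{i | a i < gap} ≤ 1 := by
    have := countP_lt_getElem_one_le (Multiset.pairwise_sort (univ.val.map a) (· ≤ ·)) hlen
    rw [countP_sort_map] at this
    unfold spectralGap eigenvalueList at hgap
    rw [hr, List.getD_eq_getElem _ _ (by omega)] at hgap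
    rwa [hgap]
  -- For a nonpositive gap, positivity of the form suffices. For a positive one, eigenfunctions with
  -- eigenvalue at least `gap` are orthogonal to the constants, which have eigenvalue 0.
  rcases le_or_gt gap 0 with hg | hg
  · exact (mul_nonpos_of_nonpos_of_nonneg hg
      (Finset.sum_nonneg fun s _ => mul_self_nonneg _)).trans (hpos f)
  have horth : ∀ i, gap ≤ a i → ∑ s, v i s = 0 := by
    intro i hi
    have := h.neg (v i) (fun _ => 1)
    rw [hv i, LinearMap.neg_apply, h1] at this
    simp only [Pi.smul_apply, smul_eq_mul, mul_one, neg_zero, Pi.zero_apply, mul_zero,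
      Finset.sum_const_zero, ← Finset.mul_sum] at this
    exact (mul_eq_zero.mp this).resolve_left (by linarith)
  have hf' : ∀ i, a i < gap → ∑ s, f s * v i s = 0 := by
    intro i hi
    have huniq : ∀ j, j ≠ i → gap ≤ a j := by
      intro j hj
      by_contra hlt
      exact hj (Finset.card_le_one.mp hcount j (by simpa using hlt) i (by simpa using hi))
    -- Only `v i` can have nonzero sum, so Parseval against 1 collapses to one term. The choice g =
    -- 1 shows that this sum is nonzero; g = f then gives `f` orthogonal to `v i`.
    have key : ∀ g : S → ℝ, ∑ s, g s = (∑ s, g s * v i s) * ∑ s, v i s := by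
      intro g
      have := hp g (fun _ => 1)
      simp only [mul_one, one_mul] at this
      rw [this, Finset.sum_eq_single i (fun j _ hj => by rw [horth j (huniq j hj), mul_zero])
        (by simp)]
    have hne : ∑ s, v i s ≠ 0 := by
      intro h0
      have := key (fun _ => 1)
      rw [h0, mul_zero] at this
      simp only [Finset.sum_const, nsmul_eq_mul, mul_one, Finset.card_univ, Nat.cast_eq_zero]
        at this
      omega
    have := key f
    rw [hf] at this
    exact (mul_eq_zero.mp this.symm).resolve_right hne
  rw [h.neg.sum_mul_apply_eq hv hp, hp f f, Finset.mul_sum]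
  refine Finset.sum_le_sum fun i _ => ?_
  rcases lt_or_ge (a i) gap with hi | hi
  · simp [hf' i hi]
  · exact mul_le_mul_of_nonneg_right hi (mul_self_nonneg _)

end Spectral

/-! ### Formal integer combinations of self-maps of `Fin m`

A self-map `g` of `Fin m` is encoded by the number with octal digits `g 0, g 1, …`. -/

/-- A formal integer combination of (codes of) self-maps of `Fin m`. -/
abbrev FormalSum : Type := List (ℤ × ℕ)

namespace FormalSum

variable {m : ℕ}

/-- The number with the given octal digits, least significant digit first. -/
def ofOctal : List ℕ → ℕ
  | [] => 0
  | d :: l => d + 8 * ofOctal l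

/-- The code of a self-map of `Fin m`. -/
def encode (g : Fin m → Fin m) : ℕ := ofOctal (List.ofFn fun i => (g i).val)

/-- The self-map of `Fin m` with a given code. -/
def decode (m k : ℕ) (i : Fin m) : Fin m :=
  -- Codes of self-maps never reach the default value `i`; it only makes the function total.
  if h : k / 8 ^ i.val % 8 < m then ⟨k / 8 ^ i.val % 8, h⟩ else i

theorem ofOctal_digit (l : List ℕ) (hl : ∀ d ∈ l, d < 8) (i : ℕ) :
    ofOctal l / 8 ^ i % 8 = l.getD i 0 := by
  induction l generalizing i with
  | nil => simp [ofOctal]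
  | cons d l ih =>
    have hd := hl d (by simp)
    cases i with
    | zero => simp only [ofOctal, pow_zero, Nat.div_one, List.getD_cons_zero]; omega
    | succ i =>
      rw [List.getD_cons_succ, ← ih (fun e he => hl e (by simp [he])) i, pow_succ',
        ← Nat.div_div_eq_div_mul, ofOctal]
      congr 2
      omega

theorem decode_encode (hm : m ≤ 8) (g : Fin m → Fin m) : decode m (encode g) = g := by
  funext i
  have h := ofOctal_digit (List.ofFn fun i => (g i).val) (by
    intro d hd
    obtain ⟨j, rfl⟩ := (List.mem_ofFn' _ _).mp hd
    exact (g j).isLt.trans_le hm) i.val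
  have h' : (List.ofFn fun i => (g i).val).getD i.val 0 = (g i).val := by simp
  rw [h'] at h
  unfold decode encode
  simp [h]

/-- The formal sum consisting of one map. -/
def single (g : Fin m → Fin m) : FormalSum := [(1, encode g)]

/-- Multiplication by a scalar. -/
def smul (a : ℤ) (p : FormalSum) : FormalSum := p.map fun t => (a * t.1, t.2)

/-- Addition of one term. -/
def insert (a : ℤ) (k : ℕ) : FormalSum → FormalSum
  | [] => [(a, k)]
  | t :: p => bif Nat.beq t.2 k then (t.1 + a, t.2) :: p else t :: insert a k p

/-- The sum of two formal sums. -/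
def add (p q : FormalSum) : FormalSum := p.foldr (fun t r => insert t.1 t.2 r) q

/-- The product of two formal sums. -/
def mul (m : ℕ) (p q : FormalSum) : FormalSum :=
  p.foldr (fun t r => q.foldr
    (fun u r' => insert (t.1 * u.1) (encode (decode m t.2 ∘ decode m u.2)) r') r) []

/-- The test whether all coefficients vanish. -/
def isZero (p : FormalSum) : Bool := p.all fun t => t.1 = 0

section Eval

variable {A : Type*} [Ring A] (F : (Fin m → Fin m) → A)

/-- The value of a formal sum in a ring. -/
def eval (p : FormalSum) : A := (p.map fun t => t.1 • F (decode m t.2)).sum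

theorem eval_cons (t : ℤ × ℕ) (p : FormalSum) :
    eval F (t :: p) = t.1 • F (decode m t.2) + eval F p := by
  simp [eval]

theorem eval_nil : eval F [] = 0 := rfl

theorem eval_single (hm : m ≤ 8) (g : Fin m → Fin m) : eval F (single g) = F g := by
  simp [eval, single, decode_encode hm]

theorem eval_smul (a : ℤ) (p : FormalSum) : eval F (smul a p) = a • eval F p := by
  induction p with
  | nil => simp [smul, eval]
  | cons t p ih =>
    have : smul a (t :: p) = (a * t.1, t.2) :: smul a p := rfl
    rw [this, eval_cons, eval_cons, ih, smul_add, smul_smul]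

theorem eval_insert (a : ℤ) (k : ℕ) (p : FormalSum) :
    eval F (insert a k p) = a • F (decode m k) + eval F p := by
  induction p with
  | nil => simp [insert, eval]
  | cons t p ih =>
    unfold insert
    cases hb : Nat.beq t.2 k with
    | true =>
      have : t.2 = k := Nat.eq_of_beq_eq_true hb
      simp only [cond_true, eval_cons, this, add_smul]
      abel
    | false =>
      simp only [cond_false, eval_cons, ih]
      abel

theorem eval_add (p q : FormalSum) : eval F (add p q) = eval F p + eval F q := by
  induction p with
  | nil => simp [add, eval_nil]
  | cons t p ih =>
    have : add (t :: p) q = insert t.1 t.2 (add p q) := rfl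
    rw [this, eval_insert, ih, eval_cons, add_assoc]

/-- Together with `eval_eq_zero` this turns arithmetic on codes into identities in any ring; `F`
only has to be multiplicative for composition. The bound 8 is the base of the code. -/
theorem eval_mul (hm : m ≤ 8) (hF : ∀ g h, F (g ∘ h) = F g * F h) (p q : FormalSum) :
    eval F (mul m p q) = eval F p * eval F q := by
  induction p with
  | nil => simp [mul, eval_nil]
  | cons t p ih =>
    have row : ∀ (q r : FormalSum), eval F (q.foldr (fun u r' => insert (t.1 * u.1)
        (encode (decode m t.2 ∘ decode m u.2)) r') r) =
        t.1 • F (decode m t.2) * eval F q + eval F r := by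
      intro q r
      induction q with
      | nil => simp [eval_nil]
      | cons u q ih =>
        rw [List.foldr_cons, eval_insert, ih, decode_encode hm, hF, eval_cons, mul_add,
          smul_mul_smul_comm, add_assoc]
    have : mul m (t :: p) q = q.foldr (fun u r' => insert (t.1 * u.1)
        (encode (decode m t.2 ∘ decode m u.2)) r') (mul m p q) := rfl
    rw [this, row, ih, eval_cons, add_mul]

theorem eval_eq_zero {p : FormalSum} (hp : isZero p = true) : eval F p = 0 := by
  induction p with
  | nil => rfl
  | cons t p ih =>
    simp only [isZero, List.all_cons, Bool.and_eq_true, decide_eq_true_eq] at hp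
    rw [eval_cons, hp.1, ih hp.2]
    simp

end Eval

/-- The transposition of `i` and `j`. -/
def swp (i j : Fin m) : FormalSum := single (Equiv.swap i j)

/-- The identity. -/
def one (m : ℕ) : FormalSum := single (id : Fin m → Fin m)

/-- The formal version of `octopusPair`. -/
def pair (o x y : Fin m) : FormalSum :=
  add (add (swp x y) (one m)) (smul (-1) (add (swp o x) (swp o y)))

/-- The formal version of `octopusProd`. -/
def prod (o x y z w : Fin m) : FormalSum :=
  mul m (add (smul (if x = y then 4 else 2) (one m)) (smul (-1) (pair o x y))) (pair o z w)

/-- The formal version of `octopusTerm`. -/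
def term (o x y z w : Fin m) : FormalSum :=
  add (add (add (prod o x y z w) (prod o z w x y)) (add (prod o x z y w) (prod o y w x z)))
    (add (prod o x w y z) (prod o y z x w))

/-- The test whether `p * p = 24 * p`. -/
def isMultipleOfIdempotent (m : ℕ) (p : FormalSum) : Bool :=
  isZero (add (mul m p p) (smul (-24) p))

/-- The collected form of `term 0 1 2 3 4`. -/
def genericTerm : FormalSum :=
  [(6, 18056), (-2, 5344), (2, 17601), (2, 1228), (2, 5666), (-2, 17937), (-2, 9740), (2, 4259),
    (-2, 16537), (-2, 12428), (-2, 2187), (-2, 1802), (-2, 17027), (-2, 17986), (-2, 14416),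
    (2, 14465), (2, 14346), (2, 16467), (2, 1620), (-2, 5764), (-2, 16586), (-2, 1697), (2, 668),
    (-2, 17419), (2, 16922), (2, 8459), (2, 9985), (-2, 8984)]

-- Collecting the six products first leaves 28 permutations, so that the next computation squares a
-- short list.
set_option maxRecDepth 100000 in
theorem term_eq_genericTerm :
    isZero (add (term (m := 5) 0 1 2 3 4) (smul (-1) genericTerm)) = true := by
  decide +kernel

-- The factor 24 can be read off at the identity: its coefficient is 6 in the term and 6² + 27·2² =
-- 144 in the square, since inverse permutations have equal coefficients.
set_option maxRecDepth 100000 in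
theorem isMultipleOfIdempotent_genericTerm : isMultipleOfIdempotent 5 genericTerm = true := by
  decide +kernel

set_option maxRecDepth 100000 in
theorem isMultipleOfIdempotent_term_xxyz :
    isMultipleOfIdempotent 4 (term (m := 4) 0 1 1 2 3) = true := by
  decide +kernel

set_option maxRecDepth 100000 in
theorem isMultipleOfIdempotent_term_xxyy :
    isMultipleOfIdempotent 3 (term (m := 3) 0 1 1 2 2) = true := by
  decide +kernel

set_option maxRecDepth 100000 in
theorem isMultipleOfIdempotent_term_xxxy :
    isMultipleOfIdempotent 3 (term (m := 3) 0 1 1 1 2) = true := by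
  decide +kernel

set_option maxRecDepth 100000 in
theorem isMultipleOfIdempotent_term_xxxx :
    isMultipleOfIdempotent 2 (term (m := 2) 0 1 1 1 1) = true := by
  decide +kernel

end FormalSum

/-! ### The terms of the octopus inequality -/

section OctopusTerms

variable {V A : Type*} [Ring A] (R : Equiv.Perm V →* A)

open Classical in
/-- The action of self-maps of `Fin m` through an embedding in `V`;
maps that are not bijective act by `0`. -/
noncomputable def selfMapRep {m : ℕ} (ι : Fin m ↪ V) (g : Fin m → Fin m) : A :=
  if h : Function.Bijective g then R (Equiv.Perm.viaEmbeddingHom ι (Equiv.ofBijective g h)) else 0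

theorem selfMapRep_perm {m : ℕ} (ι : Fin m ↪ V) (σ : Equiv.Perm (Fin m)) :
    selfMapRep R ι σ = R (Equiv.Perm.viaEmbeddingHom ι σ) := by
  rw [selfMapRep, dif_pos σ.bijective]
  congr 2
  ext
  rfl

/-- On a finite set a composite is bijective only if both factors are. Sending the other maps to 0
therefore stays multiplicative, and formal sums need no proofs of bijectivity. -/
theorem selfMapRep_comp {m : ℕ} (ι : Fin m ↪ V) (g h : Fin m → Fin m) :
    selfMapRep R ι (g ∘ h) = selfMapRep R ι g * selfMapRep R ι h := by
  by_cases hg : Function.Bijective g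
  · by_cases hh : Function.Bijective h
    · obtain ⟨σ, rfl⟩ : ∃ σ : Equiv.Perm (Fin m), ⇑σ = g := ⟨Equiv.ofBijective g hg, rfl⟩
      obtain ⟨τ, rfl⟩ : ∃ τ : Equiv.Perm (Fin m), ⇑τ = h := ⟨Equiv.ofBijective h hh, rfl⟩
      rw [← Equiv.Perm.coe_mul, selfMapRep_perm, selfMapRep_perm, selfMapRep_perm, map_mul,
        map_mul]
    · have : ¬ Function.Bijective (g ∘ h) := fun hc =>
        hh (Finite.injective_iff_bijective.mp hc.1.of_comp)
      rw [selfMapRep, dif_neg this, selfMapRep, selfMapRep, dif_neg hh, mul_zero]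
  · have : ¬ Function.Bijective (g ∘ h) := fun hc =>
      hg (Finite.surjective_iff_bijective.mp hc.2.of_comp)
    rw [selfMapRep, selfMapRep, dif_neg this, dif_neg hg, zero_mul]

open FormalSum in
theorem eval_sq_of_isMultipleOfIdempotent {m : ℕ} (hm : m ≤ 8) (ι : Fin m ↪ V)
    {p : FormalSum} {T : A} (hp : eval (selfMapRep R ι) p = T)
    (h : isMultipleOfIdempotent m p = true) : T * T = 24 • T := by
  have := eval_eq_zero (selfMapRep R ι) h
  rw [eval_add, eval_smul, eval_mul _ hm (selfMapRep_comp R ι), hp] at this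
  rw [← sub_eq_zero, ← this, sub_eq_add_neg, neg_smul]
  norm_cast

variable [DecidableEq V]

/-- `τ_{xy} + 1 - τ_{ox} - τ_{oy}`. -/
def octopusPair (o x y : V) : A :=
  R (Equiv.swap x y) + 1 - (R (Equiv.swap o x) + R (Equiv.swap o y))

/-- A product of two quadratic terms. -/
def octopusProd (o x y z w : V) : A :=
  -- For x = y the pair is P = 2 - 2τ_ox, with P² = 4P, so 4 - P annihilates it. Summed with
  -- weights, the values 4 and 2 produce the scalar 2c of `sum_octopusTerm`.
  ((if x = y then 4 else 2 : ℤ) • (1 : A) - octopusPair R o x y) * octopusPair R o z w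

/-- The sum of the products over all ways to divide `x, y, z, w` into two pairs. -/
def octopusTerm (o x y z w : V) : A :=
  octopusProd R o x y z w + octopusProd R o z w x y +
    (octopusProd R o x z y w + octopusProd R o y w x z) +
    (octopusProd R o x w y z + octopusProd R o y z x w)

theorem octopusPair_comm (o x y : V) : octopusPair R o x y = octopusPair R o y x := by
  rw [octopusPair, octopusPair, Equiv.swap_comm x y]
  abel

theorem octopusProd_comm_left (o x y z w : V) :
    octopusProd R o x y z w = octopusProd R o y x z w := by
  rw [octopusProd, octopusProd, octopusPair_comm R o x y, if_congr (eq_comm (a := x)) rfl rfl]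

theorem octopusProd_comm_right (o x y z w : V) :
    octopusProd R o x y z w = octopusProd R o x y w z := by
  rw [octopusProd, octopusProd, octopusPair_comm R o z w]

/-- This and the next two exchanges generate all permutations of the four legs, so only the pattern
of coincidences among them matters for T² = 24T. -/
theorem octopusTerm_swap_12 (o x y z w : V) :
    octopusTerm R o x y z w = octopusTerm R o y x z w := by
  simp only [octopusTerm, octopusProd_comm_left R o x y, octopusProd_comm_right R o z w x y]
  abel

theorem octopusTerm_swap_23 (o x y z w : V) :
    octopusTerm R o x y z w = octopusTerm R o x z y w := by
  simp only [octopusTerm, octopusProd_comm_left R o y z, octopusProd_comm_right R o x w y z]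
  abel

theorem octopusTerm_swap_34 (o x y z w : V) :
    octopusTerm R o x y z w = octopusTerm R o x y w z := by
  simp only [octopusTerm, octopusProd_comm_left R o z w, octopusProd_comm_right R o x y z w]
  abel

theorem viaEmbedding_swap {m : ℕ} (ι : Fin m ↪ V) (i j : Fin m) :
    Equiv.Perm.viaEmbedding (Equiv.swap i j) ι = Equiv.swap (ι i) (ι j) := by
  ext v
  by_cases hv : v ∈ Set.range ι
  · obtain ⟨k, rfl⟩ := hv
    rw [Equiv.Perm.viaEmbedding_apply, ι.injective.map_swap]
  · rw [Equiv.Perm.viaEmbedding_apply_of_notMem _ _ _ hv, Equiv.swap_apply_of_ne_of_ne]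
    · rintro rfl; exact hv ⟨i, rfl⟩
    · rintro rfl; exact hv ⟨j, rfl⟩

open FormalSum in
theorem eval_term {m : ℕ} (hm : m ≤ 8) (ι : Fin m ↪ V) (o x y z w : Fin m) :
    eval (selfMapRep R ι) (term o x y z w) =
      octopusTerm R (ι o) (ι x) (ι y) (ι z) (ι w) := by
  have hs : ∀ i j, eval (selfMapRep R ι) (swp i j) = R (Equiv.swap (ι i) (ι j)) := by
    intro i j
    rw [swp, eval_single _ hm, selfMapRep_perm, Equiv.Perm.viaEmbeddingHom_apply,
      viaEmbedding_swap]
  have h1 : eval (selfMapRep R ι) (one m) = 1 := by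
    rw [one, eval_single _ hm]
    have := selfMapRep_perm R ι 1
    rwa [map_one, map_one] at this
  have hp : ∀ x y, eval (selfMapRep R ι) (pair o x y) = octopusPair R (ι o) (ι x) (ι y) := by
    intro x y
    rw [pair, eval_add, eval_add, eval_smul, eval_add, hs, hs, hs, h1, octopusPair,
      neg_smul, one_smul, ← sub_eq_add_neg]
  have hq : ∀ x y z w, eval (selfMapRep R ι) (prod o x y z w) =
      octopusProd R (ι o) (ι x) (ι y) (ι z) (ι w) := by
    intro x y z w
    rw [prod, eval_mul _ hm (selfMapRep_comp R ι), eval_add, eval_smul, eval_smul, hp, hp, h1,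
      octopusProd]
    simp [sub_eq_add_neg, ι.injective.eq_iff]
  simp only [term, eval_add, hq, octopusTerm]

open FormalSum in
theorem octopusTerm_sq_generic {o x y z w : V} (h : Function.Injective ![o, x, y, z, w]) :
    octopusTerm R o x y z w * octopusTerm R o x y z w = 24 • octopusTerm R o x y z w := by
  refine eval_sq_of_isMultipleOfIdempotent R (by norm_num) ⟨_, h⟩ ?_
    isMultipleOfIdempotent_genericTerm
  have := eval_eq_zero (selfMapRep R ⟨_, h⟩) term_eq_genericTerm
  rw [eval_add, eval_smul, eval_term R (by norm_num), neg_smul, one_smul, ← sub_eq_add_neg,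
    sub_eq_zero] at this
  exact this.symm

open FormalSum in
/-- The terms with a repeated index. -/
theorem octopusTerm_sq_repeated {o x y z : V} (hx : x ≠ o) (hy : y ≠ o) (hz : z ≠ o) :
    octopusTerm R o x x y z * octopusTerm R o x x y z = 24 • octopusTerm R o x x y z := by
  have two : ∀ {x}, x ≠ o → Function.Injective ![o, x] := by
    intro x hx i j
    fin_cases i <;> fin_cases j <;> simp [hx, hx.symm]
  have three : ∀ {x y}, x ≠ o → y ≠ o → x ≠ y → Function.Injective ![o, x, y] := by
    intro x y hx hy hxy i j
    fin_cases i <;> fin_cases j <;> simp [hx, hx.symm, hy, hy.symm, hxy, hxy.symm]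
  have four : ∀ {x y z}, x ≠ o → y ≠ o → z ≠ o → x ≠ y → x ≠ z → y ≠ z →
      Function.Injective ![o, x, y, z] := by
    intro x y z hx hy hz hxy hxz hyz i j
    fin_cases i <;> fin_cases j <;>
      simp [hx, hx.symm, hy, hy.symm, hz, hz.symm, hxy, hxy.symm, hxz, hxz.symm, hyz, hyz.symm]
  by_cases hxy : x = y
  · subst hxy
    by_cases hxz : x = z
    · subst hxz
      exact eval_sq_of_isMultipleOfIdempotent R (by norm_num) ⟨_, two hx⟩
        (eval_term R (by norm_num) _ _ _ _ _ _) isMultipleOfIdempotent_term_xxxx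
    · exact eval_sq_of_isMultipleOfIdempotent R (by norm_num) ⟨_, three hx hz hxz⟩
        (eval_term R (by norm_num) _ _ _ _ _ _) isMultipleOfIdempotent_term_xxxy
  by_cases hxz : x = z
  · subst hxz
    rw [octopusTerm_swap_34]
    exact eval_sq_of_isMultipleOfIdempotent R (by norm_num) ⟨_, three hx hy hxy⟩
      (eval_term R (by norm_num) _ _ _ _ _ _) isMultipleOfIdempotent_term_xxxy
  by_cases hyz : y = z
  · subst hyz
    exact eval_sq_of_isMultipleOfIdempotent R (by norm_num) ⟨_, three hx hy hxy⟩
      (eval_term R (by norm_num) _ _ _ _ _ _) isMultipleOfIdempotent_term_xxyy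
  · exact eval_sq_of_isMultipleOfIdempotent R (by norm_num)
      ⟨_, four hx hy hz hxy hxz hyz⟩
      (eval_term R (by norm_num) _ _ _ _ _ _) isMultipleOfIdempotent_term_xxyz

theorem octopusTerm_sq {o x y z w : V} (hx : x ≠ o) (hy : y ≠ o) (hz : z ≠ o) (hw : w ≠ o) :
    octopusTerm R o x y z w * octopusTerm R o x y z w = 24 • octopusTerm R o x y z w := by
  by_cases hxy : x = y
  · subst hxy
    exact octopusTerm_sq_repeated R hx hz hw
  by_cases hxz : x = z
  · subst hxz
    rw [octopusTerm_swap_23]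
    exact octopusTerm_sq_repeated R hx hy hw
  by_cases hxw : x = w
  · subst hxw
    rw [octopusTerm_swap_34, octopusTerm_swap_23]
    exact octopusTerm_sq_repeated R hx hy hz
  by_cases hyz : y = z
  · subst hyz
    rw [octopusTerm_swap_12, octopusTerm_swap_23]
    exact octopusTerm_sq_repeated R hy hx hw
  by_cases hyw : y = w
  · subst hyw
    rw [octopusTerm_swap_34, octopusTerm_swap_12, octopusTerm_swap_23]
    exact octopusTerm_sq_repeated R hy hx hz
  by_cases hzw : z = w
  · subst hzw
    rw [octopusTerm_swap_23, octopusTerm_swap_12, octopusTerm_swap_34, octopusTerm_swap_23]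
    exact octopusTerm_sq_repeated R hz hx hy
  · refine octopusTerm_sq_generic R fun i j => ?_
    fin_cases i <;> fin_cases j <;>
      simp [hx, hx.symm, hy, hy.symm, hz, hz.symm, hw, hw.symm, hxy, Ne.symm hxy, hxz,
        Ne.symm hxz, hxw, Ne.symm hxw, hyz, Ne.symm hyz, hyw, Ne.symm hyw, hzw, Ne.symm hzw]

end OctopusTerms

/-! ### The octopus inequality -/

section Octopus

/-! ### Quadratic forms of symmetric operators -/

section Forms

variable {S : Type} [Fintype S]

/-- The quadratic form `⟨f, A f⟩` of an operator. -/
def quadForm (f : S → ℝ) : Operator S →ₗ[ℝ] ℝ where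
  toFun A := ∑ s, f s * A f s
  map_add' A B := by simp [mul_add, Finset.sum_add_distrib]
  map_smul' a A := by simp [mul_left_comm, Finset.mul_sum]

theorem quadForm_apply (f : S → ℝ) (A : Operator S) : quadForm f A = ∑ s, f s * A f s := rfl

theorem SymmetricOp.add {A B : Operator S} (hA : SymmetricOp A) (hB : SymmetricOp B) :
    SymmetricOp (A + B) := by
  intro f g
  simp only [LinearMap.add_apply, Pi.add_apply, add_mul, mul_add, Finset.sum_add_distrib, hA f g,
    hB f g]

theorem SymmetricOp.smul {A : Operator S} (hA : SymmetricOp A) (a : ℝ) :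
    SymmetricOp (a • A) := by
  intro f g
  simp only [LinearMap.smul_apply, Pi.smul_apply, smul_eq_mul, mul_left_comm _ a, mul_assoc a,
    ← Finset.mul_sum, hA f g]

theorem SymmetricOp.sub {A B : Operator S} (hA : SymmetricOp A) (hB : SymmetricOp B) :
    SymmetricOp (A - B) := by
  rw [sub_eq_add_neg]
  exact hA.add hB.neg

theorem SymmetricOp.one : SymmetricOp (1 : Operator S) := fun _ _ => rfl

theorem SymmetricOp.sum {I : Type*} {t : Finset I} {A : I → Operator S}
    (hA : ∀ i ∈ t, SymmetricOp (A i)) : SymmetricOp (∑ i ∈ t, A i) := by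
  classical
  induction t using Finset.induction_on with
  | empty => intro f g; simp
  | insert i t hi ih =>
    rw [Finset.sum_insert hi]
    exact (hA i (by simp)).add (ih fun j hj => hA j (by simp [hj]))

theorem SymmetricOp.mul_add_mul {A B : Operator S} (hA : SymmetricOp A) (hB : SymmetricOp B) :
    SymmetricOp (A * B + B * A) := by
  intro f g
  simp only [LinearMap.add_apply, Module.End.mul_apply, Pi.add_apply, add_mul, mul_add,
    Finset.sum_add_distrib]
  rw [hA (B f) g, hB (A f) g, hB f (A g), hA f (B g), add_comm]

theorem SymmetricOp.quadForm_mul_self_nonneg {A : Operator S} (hA : SymmetricOp A) (f : S → ℝ) :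
    0 ≤ quadForm f (A * A) := by
  rw [quadForm_apply]
  simp only [Module.End.mul_apply]
  rw [← hA]
  exact Finset.sum_nonneg fun s _ => mul_self_nonneg _

/-- Since A = A²/24, the form ⟨f, Af⟩ equals ‖Af‖²/24. -/
theorem SymmetricOp.quadForm_nonneg {A : Operator S} (hA : SymmetricOp A)
    (hA2 : A * A = 24 • A) (f : S → ℝ) : 0 ≤ quadForm f A := by
  have := hA.quadForm_mul_self_nonneg f
  rw [hA2, map_nsmul, nsmul_eq_mul] at this
  push_cast at this
  linarith

end Forms

/-- The six products in a term differ by a relabelling of the summation variables, so all have the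
same weighted sum, and that sum factorises. -/
theorem sum_octopusTerm {V A I : Type*} [DecidableEq V] [Ring A] [Algebra ℝ A] [Fintype I]
    (R : Equiv.Perm V →* A) (o : V) (e : I → V) (b : I → ℝ) :
    ∑ x, ∑ y, ∑ z, ∑ w, (b x * b y * b z * b w) • octopusTerm R o (e x) (e y) (e z) (e w) =
      (6 : ℝ) • ((2 * ∑ x, ∑ y, b x * b y * (if e x = e y then 2 else 1)) •
          (∑ x, ∑ y, (b x * b y) • octopusPair R o (e x) (e y)) -
        (∑ x, ∑ y, (b x * b y) • octopusPair R o (e x) (e y)) *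
          (∑ x, ∑ y, (b x * b y) • octopusPair R o (e x) (e y))) := by
  set Q := ∑ x, ∑ y, (b x * b y) • octopusPair R o (e x) (e y) with hQ
  set c := 2 * ∑ x, ∑ y, b x * b y * (if e x = e y then 2 else 1) with hc
  let G : I → I → I → I → A := fun x y z w =>
    (b x * b y * b z * b w) • octopusProd R o (e x) (e y) (e z) (e w)
  have h12 : ∀ H : I → I → I → I → A,
      ∑ x, ∑ y, ∑ z, ∑ w, H y x z w = ∑ x, ∑ y, ∑ z, ∑ w, H x y z w :=
    fun H => Finset.sum_comm
  have h23 : ∀ H : I → I → I → I → A,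
      ∑ x, ∑ y, ∑ z, ∑ w, H x z y w = ∑ x, ∑ y, ∑ z, ∑ w, H x y z w :=
    fun H => Finset.sum_congr rfl fun x _ => Finset.sum_comm
  have h34 : ∀ H : I → I → I → I → A,
      ∑ x, ∑ y, ∑ z, ∑ w, H x y w z = ∑ x, ∑ y, ∑ z, ∑ w, H x y z w :=
    fun H => Finset.sum_congr rfl fun x _ => Finset.sum_congr rfl fun y _ => Finset.sum_comm
  have e3 : ∑ x, ∑ y, ∑ z, ∑ w, G x z y w = ∑ x, ∑ y, ∑ z, ∑ w, G x y z w := h23 G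
  have e6 : ∑ x, ∑ y, ∑ z, ∑ w, G y z x w = ∑ x, ∑ y, ∑ z, ∑ w, G x y z w :=
    (h12 fun x y z w => G x z y w).trans e3
  have e5 : ∑ x, ∑ y, ∑ z, ∑ w, G x w y z = ∑ x, ∑ y, ∑ z, ∑ w, G x y z w :=
    (h34 fun x y z w => G x z y w).trans e3
  have e4 : ∑ x, ∑ y, ∑ z, ∑ w, G y w x z = ∑ x, ∑ y, ∑ z, ∑ w, G x y z w :=
    (h12 fun x y z w => G x w y z).trans e5
  have e2 : ∑ x, ∑ y, ∑ z, ∑ w, G z w x y = ∑ x, ∑ y, ∑ z, ∑ w, G x y z w :=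
    (h23 fun x y z w => G y w x z).trans e4
  have expand : ∀ x y z w,
      (b x * b y * b z * b w) • octopusTerm R o (e x) (e y) (e z) (e w) =
        G x y z w + G z w x y + (G x z y w + G y w x z) + (G x w y z + G y z x w) := by
    intro x y z w
    simp only [octopusTerm, smul_add, G]
    congr 1
    · congr 1
      · congr 2; ring
      · congr 2 <;> ring
    · congr 2 <;> ring
  have main : ∑ x, ∑ y, ∑ z, ∑ w, G x y z w = c • Q - Q * Q := by
    have hG : ∀ x y, ∑ z, ∑ w, G x y z w =
        (2 * (b x * b y * (if e x = e y then 2 else 1))) • Q -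
          ((b x * b y) • octopusPair R o (e x) (e y)) * Q := by
      intro x y
      rw [hQ, Finset.mul_sum, Finset.smul_sum, ← Finset.sum_sub_distrib]
      refine Finset.sum_congr rfl fun z _ => ?_
      rw [Finset.mul_sum, Finset.smul_sum, ← Finset.sum_sub_distrib]
      refine Finset.sum_congr rfl fun w _ => ?_
      simp only [G, octopusProd, sub_mul, smul_sub, smul_mul_smul_comm, smul_smul]
      congr 1
      · split_ifs
        · rw [← Int.cast_smul_eq_zsmul ℝ, smul_mul_assoc, one_mul, smul_smul]
          congr 1; push_cast; ring
        · rw [← Int.cast_smul_eq_zsmul ℝ, smul_mul_assoc, one_mul, smul_smul]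
          congr 1; push_cast; ring
      · congr 1; ring
    simp only [hG, Finset.sum_sub_distrib]
    congr 1
    · rw [hc]
      simp only [← Finset.sum_smul, ← Finset.mul_sum]
    · simp only [← Finset.sum_mul, ← hQ]
  simp only [expand, Finset.sum_add_distrib, e2, e3, e4, e5, e6, main]
  rw [show (6 : ℝ) = 1 + 1 + (1 + 1) + (1 + 1) by norm_num]
  simp only [add_smul, one_smul]

/-! ### Right translations and swap energies -/

variable {V : Type} [Fintype V] [DecidableEq V]

/-- Right translation on functions on the symmetric group. -/
def rightTranslation : Equiv.Perm V →* Operator (Equiv.Perm V) where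
  toFun σ := LinearMap.funLeft ℝ ℝ (fun η => η * σ)
  map_one' := by ext; simp [LinearMap.funLeft_apply]
  map_mul' σ τ := by
    refine LinearMap.ext fun f => funext fun η => ?_
    simp [LinearMap.funLeft_apply, mul_assoc]

theorem rightTranslation_apply (σ : Equiv.Perm V) (f : Equiv.Perm V → ℝ) (η : Equiv.Perm V) :
    rightTranslation σ f η = f (η * σ) := rfl

theorem symmetricOp_rightTranslation_swap (x y : V) :
    SymmetricOp (rightTranslation (Equiv.swap x y)) := by
  intro f g
  refine Fintype.sum_equiv (Equiv.mulRight (Equiv.swap x y)) _ _ fun η => ?_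
  simp [rightTranslation_apply, mul_assoc]

theorem symmetricOp_octopusPair (o x y : V) :
    SymmetricOp (octopusPair rightTranslation o x y) :=
  ((symmetricOp_rightTranslation_swap x y).add SymmetricOp.one).sub
    ((symmetricOp_rightTranslation_swap o x).add (symmetricOp_rightTranslation_swap o y))

/-- A product of symmetric operators need not be symmetric, but the sum of both orders is; this is
why each pairing enters the term twice. -/
theorem symmetricOp_octopusTerm (o x y z w : V) :
    SymmetricOp (octopusTerm rightTranslation o x y z w) := by
  have key : ∀ x y z w, SymmetricOp (octopusProd rightTranslation o x y z w +
      octopusProd rightTranslation o z w x y) := by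
    intro x y z w
    have hp := symmetricOp_octopusPair o x y
    have hq := symmetricOp_octopusPair o z w
    simp only [octopusProd, ← Int.cast_smul_eq_zsmul ℝ, sub_mul, smul_mul_assoc, one_mul]
    rw [sub_add_sub_comm]
    exact ((hq.smul _).add (hp.smul _)).sub (hp.mul_add_mul hq)
  exact ((key _ _ _ _).add (key _ _ _ _)).add (key _ _ _ _)

/-- The squared increments of `f` across the transposition of `x` and `y`. -/
def swapEnergy (f : Equiv.Perm V → ℝ) (x y : V) : ℝ :=
  ∑ η : Equiv.Perm V, (f (η * Equiv.swap x y) - f η) ^ 2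

theorem swapEnergy_nonneg (f : Equiv.Perm V → ℝ) (x y : V) : 0 ≤ swapEnergy f x y :=
  Finset.sum_nonneg fun _ _ => sq_nonneg _

theorem swapEnergy_comm (f : Equiv.Perm V → ℝ) (x y : V) :
    swapEnergy f x y = swapEnergy f y x := by
  rw [swapEnergy, swapEnergy, Equiv.swap_comm]

theorem swapEnergy_self (f : Equiv.Perm V → ℝ) (x : V) : swapEnergy f x x = 0 := by
  simp [swapEnergy, ← Equiv.Perm.one_def]

theorem quadForm_rightTranslation_swap (f : Equiv.Perm V → ℝ) (x y : V) :
    quadForm f (rightTranslation (Equiv.swap x y)) = quadForm f 1 - swapEnergy f x y / 2 := by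
  have h : ∑ η : Equiv.Perm V, f (η * Equiv.swap x y) ^ 2 = ∑ η, f η ^ 2 :=
    Fintype.sum_equiv (Equiv.mulRight (Equiv.swap x y)) _ _ fun η => rfl
  have h2 : swapEnergy f x y = ∑ η, f (η * Equiv.swap x y) ^ 2 + ∑ η, f η ^ 2 -
      2 * ∑ η, f η * f (η * Equiv.swap x y) := by
    rw [swapEnergy, Finset.mul_sum, ← Finset.sum_add_distrib, ← Finset.sum_sub_distrib]
    exact Finset.sum_congr rfl fun η _ => by ring
  rw [h] at h2
  simp only [quadForm_apply, rightTranslation_apply, Module.End.one_apply, ← sq]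
  linarith

/-- The octopus inequality. -/
theorem octopus_inequality {I : Type*} [Fintype I] (o : V) (e : I → V) (he : ∀ i, e i ≠ o)
    (b : I → ℝ) (hb : ∀ i, 0 ≤ b i) (f : Equiv.Perm V → ℝ) :
    ∑ x, ∑ y, b x * b y * swapEnergy f (e x) (e y) ≤
      2 * (∑ x, b x) * ∑ x, b x * swapEnergy f o (e x) := by
  set Q := ∑ x, ∑ y, (b x * b y) •
    octopusPair (rightTranslation (V := V)) o (e x) (e y) with hQ
  -- Writing E for the swap energy, each pair contributes (E(o,x) + E(o,y) - E(x,y))/2, so the claim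
  -- is exactly that the form of Q is nonnegative.
  have hform : quadForm f Q = (2 * (∑ x, b x) * ∑ x, b x * swapEnergy f o (e x) -
      ∑ x, ∑ y, b x * b y * swapEnergy f (e x) (e y)) / 2 := by
    have h1 : quadForm f Q = ∑ x, ∑ y, (b x * (b y * swapEnergy f o (e y)) +
        b x * swapEnergy f o (e x) * b y - b x * b y * swapEnergy f (e x) (e y)) / 2 := by
      rw [hQ, map_sum]
      refine Finset.sum_congr rfl fun x _ => ?_
      rw [map_sum]
      refine Finset.sum_congr rfl fun y _ => ?_
      rw [map_smul, octopusPair, map_sub, map_add, map_add]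
      simp only [quadForm_rightTranslation_swap, smul_eq_mul]
      ring
    rw [h1]
    simp only [← Finset.sum_div, Finset.sum_sub_distrib, Finset.sum_add_distrib,
      ← Finset.mul_sum, ← Finset.sum_mul]
    ring
  have hQs : SymmetricOp Q := SymmetricOp.sum fun x _ => SymmetricOp.sum fun y _ =>
    (symmetricOp_octopusPair o (e x) (e y)).smul _
  have hsum := congrArg (quadForm f) (sum_octopusTerm rightTranslation o e b)
  rw [← hQ, map_smul, map_sub, map_smul] at hsum
  have hpos : 0 ≤ quadForm f (∑ x, ∑ y, ∑ z, ∑ w,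
      (b x * b y * b z * b w) • octopusTerm rightTranslation o (e x) (e y) (e z) (e w)) := by
    simp only [map_sum, map_smul]
    refine Finset.sum_nonneg fun x _ => Finset.sum_nonneg fun y _ =>
      Finset.sum_nonneg fun z _ => Finset.sum_nonneg fun w _ => ?_
    exact mul_nonneg (mul_nonneg (mul_nonneg (mul_nonneg (hb x) (hb y)) (hb z)) (hb w))
      ((symmetricOp_octopusTerm _ _ _ _ _).quadForm_nonneg
        (octopusTerm_sq _ (he x) (he y) (he z) (he w)) f)
  set c := ∑ x, ∑ y, b x * b y * (if e x = e y then (2 : ℝ) else 1) with hc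
  rw [hsum] at hpos
  simp only [smul_eq_mul] at hpos
  have hQQ := hQs.quadForm_mul_self_nonneg f
  have hnn : ∀ x y, 0 ≤ b x * b y * (if e x = e y then (2 : ℝ) else 1) := fun x y =>
    mul_nonneg (mul_nonneg (hb x) (hb y)) (by split_ifs <;> norm_num)
  have hc0 : 0 ≤ c := Finset.sum_nonneg fun x _ => Finset.sum_nonneg fun y _ => hnn x y
  -- If c = 0, its diagonal terms 2b_x² force every weight to vanish. Otherwise 2c⟨f, Qf⟩ ≥ ‖Qf‖²
  -- may be divided by c.
  rcases hc0.eq_or_lt with h0 | h0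
  · have hb0 : ∀ x, b x = 0 := by
      intro x
      have h1 := (Finset.sum_eq_zero_iff_of_nonneg
        (fun x _ => Finset.sum_nonneg fun y _ => hnn x y)).mp (hc.symm.trans h0.symm) x (mem_univ x)
      have h2 := (Finset.sum_eq_zero_iff_of_nonneg (fun y _ => hnn x y)).mp h1 x (mem_univ x)
      simpa using h2
    simp [hb0]
  · have : 0 ≤ c * quadForm f Q := by linarith
    have := nonneg_of_mul_nonneg_right this h0
    linarith

end Octopus

/-! ### Dirichlet forms -/

theorem sum_lt_eq_half_sum {n : ℕ} (F : Fin n → Fin n → ℝ) (hs : ∀ x y, F x y = F y x)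
    (hd : ∀ x, F x x = 0) :
    ∑ p : Fin n × Fin n with p.1 < p.2, F p.1 p.2 = (∑ x, ∑ y, F x y) / 2 := by
  have h1 : ∑ x, ∑ y, F x y = ∑ p : Fin n × Fin n, F p.1 p.2 := (Fintype.sum_prod_type' _).symm
  have h2 : ∑ p : Fin n × Fin n with p.2 < p.1, F p.1 p.2 =
      ∑ p : Fin n × Fin n with p.1 < p.2, F p.1 p.2 := by
    refine Finset.sum_nbij' Prod.swap Prod.swap ?_ ?_ ?_ ?_ ?_ <;> simp
    intro a b _
    exact hs a b
  have h3 : ∀ p : Fin n × Fin n, F p.1 p.2 =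
      (if p.1 < p.2 then F p.1 p.2 else 0) + (if p.2 < p.1 then F p.1 p.2 else 0) := by
    rintro ⟨x, y⟩
    rcases lt_trichotomy x y with h | h | h
    · simp [h, h.not_gt]
    · simp [h, hd]
    · simp [h, h.not_gt]
  have h4 : ∑ p : Fin n × Fin n, F p.1 p.2 = ∑ p : Fin n × Fin n with p.1 < p.2, F p.1 p.2 +
      ∑ p : Fin n × Fin n with p.2 < p.1, F p.1 p.2 := by
    rw [Finset.sum_filter, Finset.sum_filter, ← Finset.sum_add_distrib]
    exact Finset.sum_congr rfl fun p _ => h3 p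
  rw [h1, h4, h2]
  ring

/-! ### Generators built from involutions -/

section EdgeGenerator

variable {n : ℕ} (G : WeightedGraph n) {S : Type} {act : Fin n → Fin n → S → S}

theorem edgeGenerator_apply (f : S → ℝ) (s : S) : edgeGenerator G act f s =
    ∑ p : Fin n × Fin n with p.1 < p.2, G.weight p.1 p.2 * (f (act p.1 p.2 s) - f s) := rfl

theorem edgeGenerator_one : edgeGenerator G act (fun _ => 1) = 0 := by
  funext s
  simp [edgeGenerator_apply]

/-- Summation by parts: each involution preserves the counting measure and reverses the sign of the
increment of `f`. -/
theorem sum_edgeGenerator_mul [Fintype S] (hact : ∀ x y, Function.Involutive (act x y))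
    (f g : S → ℝ) :
    ∑ s, edgeGenerator G act f s * g s =
      -(∑ p : Fin n × Fin n with p.1 < p.2, G.weight p.1 p.2 *
        ∑ s, (f (act p.1 p.2 s) - f s) * (g (act p.1 p.2 s) - g s)) / 2 := by
  have key : ∀ x y, ∑ s, (f (act x y s) - f s) * (g (act x y s) - g s) =
      -2 * ∑ s, (f (act x y s) - f s) * g s := by
    intro x y
    have h : ∑ s, (f (act x y s) - f s) * g (act x y s) = ∑ s, (f s - f (act x y s)) * g s :=
      Fintype.sum_equiv (hact x y).toPerm _ _ fun s => by
        simp [hact x y s]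
    have h' : ∑ s, (f s - f (act x y s)) * g s = -∑ s, (f (act x y s) - f s) * g s := by
      rw [← Finset.sum_neg_distrib]
      exact Finset.sum_congr rfl fun s _ => by ring
    simp only [mul_sub _ (g _) (g _), Finset.sum_sub_distrib, h, h']
    ring
  simp only [key, edgeGenerator_apply, Finset.sum_mul]
  rw [Finset.sum_comm, ← Finset.sum_neg_distrib, Finset.sum_div]
  refine Finset.sum_congr rfl fun p _ => ?_
  simp only [mul_assoc, ← Finset.mul_sum]
  ring

theorem symmetricOp_edgeGenerator [Fintype S] (hact : ∀ x y, Function.Involutive (act x y)) :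
    SymmetricOp (edgeGenerator G act) := by
  intro f g
  simp only [mul_comm (f _)]
  rw [sum_edgeGenerator_mul G hact, sum_edgeGenerator_mul G hact]
  simp only [mul_comm (g _ - g _)]

end EdgeGenerator

/-! ### The random walk and its Dirichlet form -/

section RandomWalk

variable {n : ℕ} (G : WeightedGraph n)

theorem randomWalk_apply (g : Fin n → ℝ) (x : Fin n) :
    randomWalk G g x = ∑ y, G.weight x y * (g y - g x) := by
  change ∑ y : Fin n with y ≠ x, G.weight x y * (g y - g x) = _
  rw [Finset.sum_filter]
  refine Finset.sum_congr rfl fun y _ => ?_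
  by_cases h : y = x <;> simp [h]

theorem randomWalk_one : randomWalk G (fun _ => 1) = 0 := by
  funext s
  simp [randomWalk_apply]

theorem sum_randomWalk_mul (f g : Fin n → ℝ) :
    ∑ x, randomWalk G f x * g x =
      -(∑ x, ∑ y, G.weight x y * ((f y - f x) * (g y - g x))) / 2 := by
  have h1 : ∑ x, randomWalk G f x * g x = ∑ x, ∑ y, G.weight x y * (f y - f x) * g x := by
    simp only [randomWalk_apply, Finset.sum_mul]
  have h2 : ∑ x, ∑ y, G.weight x y * (f y - f x) * g y =
      -∑ x, ∑ y, G.weight x y * (f y - f x) * g x := by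
    rw [Finset.sum_comm, ← Finset.sum_neg_distrib]
    refine Finset.sum_congr rfl fun x _ => ?_
    rw [← Finset.sum_neg_distrib]
    refine Finset.sum_congr rfl fun y _ => ?_
    rw [G.symm]
    ring
  have h3 : ∑ x, ∑ y, G.weight x y * ((f y - f x) * (g y - g x)) =
      ∑ x, ∑ y, G.weight x y * (f y - f x) * g y -
        ∑ x, ∑ y, G.weight x y * (f y - f x) * g x := by
    simp only [← Finset.sum_sub_distrib]
    exact Finset.sum_congr rfl fun x _ => Finset.sum_congr rfl fun y _ => by ring
  rw [h3, h1, h2]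
  ring

theorem symmetricOp_randomWalk : SymmetricOp (randomWalk G) := by
  intro f g
  simp only [mul_comm (f _)]
  rw [sum_randomWalk_mul, sum_randomWalk_mul]
  simp only [mul_comm (g _ - g _)]

theorem sum_neg_randomWalk_mul_self (g : Fin n → ℝ) :
    ∑ x, (-randomWalk G) g x * g x = (∑ x, ∑ y, G.weight x y * (g y - g x) ^ 2) / 2 := by
  simp only [LinearMap.neg_apply, Pi.neg_apply, neg_mul, Finset.sum_neg_distrib,
    sum_randomWalk_mul, sq]
  ring

theorem sum_neg_randomWalk_mul_self_nonneg (g : Fin n → ℝ) :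
    0 ≤ ∑ x, (-randomWalk G) g x * g x := by
  rw [sum_neg_randomWalk_mul_self]
  refine div_nonneg (Finset.sum_nonneg fun x _ => Finset.sum_nonneg fun y _ => ?_) two_pos.le
  by_cases h : x = y
  · simp [h]
  · exact mul_nonneg (G.nonneg x y h) (sq_nonneg _)

/-- The random walk moves by the transpositions of its position. -/
theorem randomWalk_eq_edgeGenerator :
    randomWalk G = edgeGenerator G fun x y u => Equiv.swap x y u := by
  refine LinearMap.ext fun g => funext fun u => ?_
  rw [randomWalk_apply, edgeGenerator_apply,
    sum_lt_eq_half_sum (fun x y => G.weight x y * (g (Equiv.swap x y u) - g u))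
      (fun x y => by rw [G.symm, Equiv.swap_comm]) (fun x => by simp)]
  -- Only transpositions involving u move u; each occurs in both orders, which the factor 1/2
  -- compensates.
  have h : ∀ x y, G.weight x y * (g (Equiv.swap x y u) - g u) =
      (if x = u then G.weight u y * (g y - g u) else 0) +
        (if y = u then G.weight u x * (g x - g u) else 0) := by
    intro x y
    by_cases hx : x = u
    · subst hx
      by_cases hy : y = x
      · subst hy; simp
      · simp [hy]
    · by_cases hy : y = u
      · subst hy
        simp [hx, G.symm]
      · simp [hx, hy, Equiv.swap_apply_of_ne_of_ne (Ne.symm hx) (Ne.symm hy)]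
  simp only [h, Finset.sum_add_distrib]
  rw [Finset.sum_comm]
  simp

end RandomWalk

/-! ### The interchange process and its one-particle marginals -/

section Interchange

variable {n : ℕ} (G : WeightedGraph n)

theorem involutive_mul_swap (x y : Fin n) :
    Function.Involutive fun η : Equiv.Perm (Fin n) => η * Equiv.swap x y := by
  intro η
  simp [mul_assoc]

theorem symmetricOp_interchange : SymmetricOp (interchange G) :=
  symmetricOp_edgeGenerator G involutive_mul_swap

theorem sum_neg_interchange_mul_self (f : Equiv.Perm (Fin n) → ℝ) :
    ∑ η, (-interchange G) f η * f η = (∑ x, ∑ y, G.weight x y * swapEnergy f x y) / 4 := by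
  simp only [LinearMap.neg_apply, Pi.neg_apply, neg_mul, Finset.sum_neg_distrib]
  rw [interchange, sum_edgeGenerator_mul G involutive_mul_swap]
  have := sum_lt_eq_half_sum (fun x y => G.weight x y * swapEnergy f x y)
    (fun x y => by rw [G.symm, swapEnergy_comm]) (fun x => by rw [swapEnergy_self, mul_zero])
  simp only [swapEnergy, sq] at this ⊢
  rw [this]
  ring

theorem sum_neg_interchange_mul_self_nonneg (f : Equiv.Perm (Fin n) → ℝ) :
    0 ≤ ∑ η, (-interchange G) f η * f η := by
  rw [sum_neg_interchange_mul_self]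
  refine div_nonneg (Finset.sum_nonneg fun x _ => Finset.sum_nonneg fun y _ => ?_) (by norm_num)
  by_cases h : x = y
  · simp [h, swapEnergy_self]
  · exact mul_nonneg (G.nonneg x y h) (swapEnergy_nonneg _ _ _)

/-- The sum of `f` over the states with particle `i` at `x`. -/
def marginal (f : Equiv.Perm (Fin n) → ℝ) (i x : Fin n) : ℝ :=
  ∑ η : Equiv.Perm (Fin n), if η x = i then f η else 0

theorem sum_marginal (f : Equiv.Perm (Fin n) → ℝ) (i : Fin n) :
    ∑ x, marginal f i x = ∑ η, f η := by
  unfold marginal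
  rw [Finset.sum_comm]
  refine Finset.sum_congr rfl fun η _ => ?_
  rw [Finset.sum_congr rfl fun x _ => by rw [if_congr (Equiv.eq_symm_apply η).symm rfl rfl]]
  simp

/-- Right multiplication by τ_xy carries the states with particle i at u to those with i at τ_xy u.
Hence marginals of interchange eigenfunctions are zero or random walk eigenfunctions. -/
theorem randomWalk_marginal (f : Equiv.Perm (Fin n) → ℝ) (i : Fin n) :
    randomWalk G (marginal f i) = marginal (interchange G f) i := by
  rw [randomWalk_eq_edgeGenerator]
  funext u
  have hswap : ∀ x y, marginal f i (Equiv.swap x y u) =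
      ∑ η : Equiv.Perm (Fin n), if η u = i then f (η * Equiv.swap x y) else 0 := by
    intro x y
    refine Fintype.sum_equiv (Equiv.mulRight (Equiv.swap x y)) _ _ fun η => ?_
    simp [mul_assoc]
  rw [edgeGenerator_apply]
  have : ∀ η : Equiv.Perm (Fin n), (if η u = i then interchange G f η else 0) =
      ∑ p : Fin n × Fin n with p.1 < p.2, G.weight p.1 p.2 *
        ((if η u = i then f (η * Equiv.swap p.1 p.2) else 0) - if η u = i then f η else 0) := by
    intro η
    split_ifs
    · rfl
    · simp
  rw [marginal.eq_def (interchange G f), Finset.sum_congr rfl fun η _ => this η, Finset.sum_comm]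
  refine Finset.sum_congr rfl fun p _ => ?_
  rw [hswap, marginal, ← Finset.sum_sub_distrib, Finset.mul_sum]

end Interchange

/-! ### Removal of a vertex -/

section Reduction

variable {n : ℕ} (G : WeightedGraph (n + 1))

/-- The total weight of the edges at the vertex `0`. -/
noncomputable def WeightedGraph.rootWeight : ℝ := ∑ u : Fin n, G.weight 0 u.succ

theorem WeightedGraph.weight_zero_succ_nonneg (u : Fin n) : 0 ≤ G.weight 0 u.succ :=
  G.nonneg _ _ (Fin.succ_ne_zero u).symm

theorem WeightedGraph.rootWeight_nonneg : 0 ≤ G.rootWeight :=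
  Finset.sum_nonneg fun u _ => G.weight_zero_succ_nonneg u

theorem WeightedGraph.weight_zero_succ_eq_zero (h : G.rootWeight = 0) (u : Fin n) :
    G.weight 0 u.succ = 0 :=
  (Finset.sum_eq_zero_iff_of_nonneg fun u _ => G.weight_zero_succ_nonneg u).mp h u (mem_univ u)

/-- The graph obtained by removing the vertex `0`, with the weights of the electrical network in
which that vertex is eliminated. -/
noncomputable def WeightedGraph.reduce : WeightedGraph n where
  -- If vertex 0 has no weight, the quotient is 0/0 = 0 and the vertex simply disappears.
  weight y z := G.weight y.succ z.succ + G.weight 0 y.succ * G.weight 0 z.succ / G.rootWeight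
  symm y z := by rw [G.symm y.succ, mul_comm (G.weight 0 y.succ)]
  nonneg y z h := add_nonneg (G.nonneg _ _ fun hc => h (Fin.succ_injective _ hc))
    (div_nonneg (mul_nonneg (G.weight_zero_succ_nonneg y) (G.weight_zero_succ_nonneg z))
      G.rootWeight_nonneg)

theorem WeightedGraph.sum_weight_mul (F : Fin (n + 1) → Fin (n + 1) → ℝ)
    (hs : ∀ x y, F x y = F y x) (hd : ∀ x, F x x = 0) :
    ∑ x, ∑ y, G.weight x y * F x y = 2 * ∑ y : Fin n, G.weight 0 y.succ * F 0 y.succ +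
      ∑ y : Fin n, ∑ z : Fin n, G.weight y.succ z.succ * F y.succ z.succ := by
  simp only [Fin.sum_univ_succ, hd, mul_zero, zero_add, Finset.sum_add_distrib]
  simp only [fun y : Fin n => G.symm y.succ 0, fun y : Fin n => hs y.succ 0]
  ring

theorem WeightedGraph.sum_reduce_weight_mul (F : Fin n → Fin n → ℝ) :
    ∑ y, ∑ z, G.reduce.weight y z * F y z = ∑ y, ∑ z, G.weight y.succ z.succ * F y z +
      (∑ y, ∑ z, G.weight 0 y.succ * G.weight 0 z.succ * F y z) / G.rootWeight := by
  simp only [WeightedGraph.reduce, add_mul, Finset.sum_add_distrib, Finset.sum_div]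
  congr 1
  exact Finset.sum_congr rfl fun y _ => Finset.sum_congr rfl fun z _ => by ring

/-- A Poincaré inequality for the random walk passes to the reduced graph. -/
theorem randomWalk_reduce_form_ge {t : ℝ} (ht : 0 ≤ t)
    (h : ∀ g : Fin (n + 1) → ℝ, ∑ x, g x = 0 →
      t * ∑ x, g x * g x ≤ ∑ x, (-randomWalk G) g x * g x)
    (g : Fin n → ℝ) (hg : ∑ x, g x = 0) :
    t * ∑ x, g x * g x ≤ ∑ x, (-randomWalk G.reduce) g x * g x := by
  set b : Fin n → ℝ := fun u => G.weight 0 u.succ with hb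
  -- The extension of `g` by its weighted mean at vertex 0 minimises the energy there; by `h4` its
  -- energy in `G` is that of `g` in the reduced graph.
  set a := (∑ u, b u * g u) / G.rootWeight with ha
  set k : Fin (n + 1) → ℝ := Fin.cons a g with hk
  set m := (∑ r, k r) / Fintype.card (Fin (n + 1)) with hm
  have h1 := h (fun x => k x - m) (sum_sub_mean k)
  rw [sum_neg_randomWalk_mul_self] at h1 ⊢
  rw [G.sum_weight_mul (fun x y => (k y - m - (k x - m)) ^ 2) (fun x y => by ring)
    (fun x => by ring)] at h1
  rw [G.sum_reduce_weight_mul fun y z => (g z - g y) ^ 2]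
  simp only [sub_sub_sub_cancel_right, hk, Fin.cons_succ, Fin.cons_zero] at h1
  -- As `g` has sum zero, the right side exceeds the left by (a - m)² + nm².
  have h2 : ∑ x, g x * g x ≤ ∑ x, (k x - m) * (k x - m) := by
    have : ∑ y, (g y - m) * (g y - m) = ∑ y, g y * g y - 2 * m * ∑ y, g y + n * (m * m) := by
      have hc : (n : ℝ) * (m * m) = ∑ _y : Fin n, m * m := by simp
      rw [hc, Finset.mul_sum, ← Finset.sum_sub_distrib, ← Finset.sum_add_distrib]
      exact Finset.sum_congr rfl fun y _ => by ring
    rw [Fin.sum_univ_succ]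
    simp only [hk, Fin.cons_succ, Fin.cons_zero]
    rw [this, hg]
    have h3 : 0 ≤ (n : ℝ) * (m * m) := mul_nonneg (Nat.cast_nonneg n) (mul_self_nonneg m)
    nlinarith [mul_self_nonneg (a - m)]
  have h4 : (∑ y, ∑ z, b y * b z * (g z - g y) ^ 2) / G.rootWeight =
      2 * ∑ y, b y * (g y - a) ^ 2 := by
    rcases eq_or_ne G.rootWeight 0 with h0 | h0
    · simp [hb, G.weight_zero_succ_eq_zero h0]
    · have haC : ∑ u, b u * g u = a * G.rootWeight := by rw [ha, div_mul_cancel₀ _ h0]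
      have hC : ∑ u, b u = G.rootWeight := rfl
      have e1 : ∑ y, ∑ z, b y * b z * (g z - g y) ^ 2 =
          2 * (∑ u, b u) * (∑ u, b u * g u ^ 2) - 2 * (∑ u, b u * g u) * (∑ u, b u * g u) := by
        have : ∀ y z, b y * b z * (g z - g y) ^ 2 = b y * (b z * g z ^ 2) + b y * g y ^ 2 * b z -
            2 * (b y * g y) * (b z * g z) := fun y z => by ring
        simp only [this, Finset.sum_add_distrib, Finset.sum_sub_distrib, ← Finset.mul_sum,
          ← Finset.sum_mul]
        ring
      have e2 : ∑ y, b y * (g y - a) ^ 2 =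
          ∑ u, b u * g u ^ 2 - 2 * a * (∑ u, b u * g u) + a ^ 2 * ∑ u, b u := by
        simp only [Finset.mul_sum]
        rw [← Finset.sum_sub_distrib, ← Finset.sum_add_distrib]
        exact Finset.sum_congr rfl fun y _ => by ring
      rw [e1, e2, hC, haC]
      field_simp
      ring
  rw [h4]
  have h5 := mul_le_mul_of_nonneg_left h2 ht
  have h6 : ∑ y, b y * (g y - a) ^ 2 = ∑ y, G.weight 0 y.succ * (g y - a) ^ 2 := rfl
  linarith

/-- The states with particle p at vertex 0 are parametrised by `e`, and transpositions of the other
vertices act on `e` alone. Each such fibre thus carries an interchange process on n vertices. -/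
theorem decomposeFin_symm_mul_swap (p : Fin (n + 1)) (e : Equiv.Perm (Fin n)) (y z : Fin n) :
    Equiv.Perm.decomposeFin.symm (p, e) * Equiv.swap y.succ z.succ =
      Equiv.Perm.decomposeFin.symm (p, e * Equiv.swap y z) := by
  refine Equiv.ext fun x => ?_
  rw [Equiv.Perm.mul_apply]
  induction x using Fin.cases with
  | zero =>
    rw [Equiv.swap_apply_of_ne_of_ne (Fin.succ_ne_zero y).symm (Fin.succ_ne_zero z).symm,
      Equiv.Perm.decomposeFin_symm_apply_zero, Equiv.Perm.decomposeFin_symm_apply_zero]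
  | succ x =>
    rw [← (Fin.succ_injective n).map_swap, Equiv.Perm.decomposeFin_symm_apply_succ,
      Equiv.Perm.decomposeFin_symm_apply_succ, Equiv.Perm.mul_apply]

theorem sum_perm_succ (F : Equiv.Perm (Fin (n + 1)) → ℝ) :
    ∑ η, F η = ∑ p, ∑ e, F (Equiv.Perm.decomposeFin.symm (p, e)) := by
  rw [← Fintype.sum_prod_type' fun p e => F (Equiv.Perm.decomposeFin.symm (p, e))]
  exact (Fintype.sum_equiv Equiv.Perm.decomposeFin.symm _ _ fun _ => rfl).symm

theorem swapEnergy_succ (f : Equiv.Perm (Fin (n + 1)) → ℝ) (y z : Fin n) :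
    swapEnergy f y.succ z.succ =
      ∑ p, swapEnergy (fun e => f (Equiv.Perm.decomposeFin.symm (p, e))) y z := by
  rw [swapEnergy, sum_perm_succ]
  simp only [decomposeFin_symm_mul_swap]
  rfl

theorem marginal_zero (f : Equiv.Perm (Fin (n + 1)) → ℝ) (p : Fin (n + 1)) :
    marginal f p 0 = ∑ e, f (Equiv.Perm.decomposeFin.symm (p, e)) := by
  rw [marginal, sum_perm_succ]
  simp only [Equiv.Perm.decomposeFin_symm_apply_zero]
  rw [Finset.sum_eq_single p (fun q _ hq => by simp [hq]) (by simp)]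
  simp

/-- The octopus inequality compares the interchange process with that of the reduced graph,
run on the states with a given particle at the vertex `0`. -/
theorem sum_interchange_reduce_le (f : Equiv.Perm (Fin (n + 1)) → ℝ) :
    ∑ p, ∑ e, (-interchange G.reduce) (fun e => f (Equiv.Perm.decomposeFin.symm (p, e))) e *
        f (Equiv.Perm.decomposeFin.symm (p, e)) ≤
      ∑ η, (-interchange G) f η * f η := by
  have hp := fun p => sum_neg_interchange_mul_self G.reduce
    fun e => f (Equiv.Perm.decomposeFin.symm (p, e))
  rw [Finset.sum_congr rfl fun p _ => hp p, ← Finset.sum_div, sum_neg_interchange_mul_self,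
    G.sum_weight_mul _ (swapEnergy_comm f) (swapEnergy_self f), Finset.sum_comm,
    Finset.sum_congr rfl fun y _ => Finset.sum_comm]
  simp only [← Finset.mul_sum, ← swapEnergy_succ]
  rw [G.sum_reduce_weight_mul fun y z => swapEnergy f y.succ z.succ]
  -- With centre 0, this bounds the energy of the conductances created by the elimination by that of
  -- the deleted edges.
  have hoct := octopus_inequality 0 Fin.succ Fin.succ_ne_zero (fun u : Fin n => G.weight 0 u.succ)
    G.weight_zero_succ_nonneg f
  have : (∑ y : Fin n, ∑ z : Fin n, G.weight 0 y.succ * G.weight 0 z.succ *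
      swapEnergy f y.succ z.succ) / G.rootWeight ≤
      2 * ∑ y : Fin n, G.weight 0 y.succ * swapEnergy f 0 y.succ := by
    rcases G.rootWeight_nonneg.eq_or_lt with h0 | h0
    · simp [G.weight_zero_succ_eq_zero h0.symm]
    · rw [div_le_iff₀ h0]
      refine hoct.trans (le_of_eq ?_)
      rw [WeightedGraph.rootWeight]
      ring
  linarith

end Reduction

/-- Aldous' spectral gap theorem: a Poincaré inequality for the random walk holds for the
interchange process with the same constant. -/
theorem interchange_form_ge {n : ℕ} (G : WeightedGraph n) {t : ℝ}
    (h : ∀ g : Fin n → ℝ, ∑ x, g x = 0 →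
      t * ∑ x, g x * g x ≤ ∑ x, (-randomWalk G) g x * g x)
    (f : Equiv.Perm (Fin n) → ℝ) (hf : ∑ η, f η = 0) :
    t * ∑ η, f η * f η ≤ ∑ η, (-interchange G) f η * f η := by
  induction n with
  | zero =>
    have : ∀ η, f η = 0 := fun η => by rwa [Fintype.sum_subsingleton _ η] at hf
    simp [this]
  | succ n ih =>
    -- Passing to the reduced graph needs t ≥ 0; for t ≤ 0 the claim follows from positivity of the
    -- form.
    rcases le_or_gt t 0 with ht | ht
    · exact (mul_nonpos_of_nonpos_of_nonneg ht
        (Finset.sum_nonneg fun _ _ => mul_self_nonneg _)).trans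
        (sum_neg_interchange_mul_self_nonneg G f)
    refine (symmetricOp_interchange G).neg.form_ge_of_eigenvalue_ge ?_ ?_ f hf
    · rw [LinearMap.neg_apply, interchange, edgeGenerator_one, neg_zero]
    intro f μ hf0 hf hμ
    have pos_of_ne : ∀ {S : Type} [Fintype S] (g : S → ℝ), g ≠ 0 → 0 < ∑ s, g s * g s := by
      intro S _ g hg
      obtain ⟨s, hs⟩ := Function.ne_iff.mp hg
      exact Finset.sum_pos' (fun _ _ => mul_self_nonneg _)
        ⟨s, mem_univ s, mul_self_pos.mpr hs⟩
    -- Vanishing marginals at vertex 0 make every fibre function sum to zero, so induction applies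
    -- on each fibre. A nonzero marginal is instead a random walk eigenfunction for the same μ.
    by_cases hm : ∀ i, marginal f i = 0
    · have key : ∀ p, t * ∑ e, f (Equiv.Perm.decomposeFin.symm (p, e)) *
          f (Equiv.Perm.decomposeFin.symm (p, e)) ≤
          ∑ e, (-interchange G.reduce) (fun e => f (Equiv.Perm.decomposeFin.symm (p, e))) e *
            f (Equiv.Perm.decomposeFin.symm (p, e)) := fun p =>
        ih G.reduce (randomWalk_reduce_form_ge G ht.le h) _
          (by rw [← marginal_zero, hm]; rfl)
      have h1 := (Finset.sum_le_sum fun p _ => key p).trans (sum_interchange_reduce_le G f)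
      rw [← Finset.mul_sum, ← sum_perm_succ fun η => f η * f η, hμ] at h1
      simp only [Pi.smul_apply, smul_eq_mul, mul_assoc, ← Finset.mul_sum] at h1
      exact le_of_mul_le_mul_right h1 (pos_of_ne f hf0)
    · push Not at hm
      obtain ⟨i, hi⟩ := hm
      have h1 := h (marginal f i) (by rw [sum_marginal, hf])
      have h2 : (-randomWalk G) (marginal f i) = μ • marginal f i := by
        rw [LinearMap.neg_apply] at hμ ⊢
        rw [randomWalk_marginal, ← neg_eq_iff_eq_neg.mpr hμ.symm]
        funext x
        simp only [Pi.neg_apply, Pi.smul_apply, smul_eq_mul, marginal, Finset.mul_sum,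
          ← Finset.sum_neg_distrib]
        exact Finset.sum_congr rfl fun η _ => by split_ifs <;> simp
      rw [h2] at h1
      simp only [Pi.smul_apply, smul_eq_mul, mul_assoc, ← Finset.mul_sum] at h1
      exact le_of_mul_le_mul_right h1 (pos_of_ne _ hi)

/-! ### Sub-processes of the interchange process -/

/-- A nonconstant eigenfunction pulls back along the surjection to a nonconstant one. Its mean-free
part is nonzero, and the Poincaré inequality with the random walk gap bounds its eigenvalue. -/
theorem spectralGap_ge_of_isSubprocessVia {n : ℕ} (hn : 2 ≤ n) (G : WeightedGraph n) {S : Type}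
    [Finite S] [Nontrivial S] {act : Fin n → Fin n → S → S}
    (hact : ∀ x y, Function.Involutive (act x y)) {π : Equiv.Perm (Fin n) → S}
    (hπ : IsSubprocessVia (edgeGenerator G act) (interchange G) π) :
    spectralGap (edgeGenerator G act) ≥ spectralGap (randomWalk G) := by
  have := Fintype.ofFinite S
  refine le_spectralGap (symmetricOp_edgeGenerator G hact) Fintype.one_lt_card ?_
  intro f μ hf hμ
  have h1 : (-interchange G) (f ∘ π) = μ • (f ∘ π) := by
    rw [LinearMap.neg_apply, hπ.2]
    funext η
    exact congrFun hμ (π η)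
  have h2 := (symmetricOp_interchange G).neg.apply_sub_mean
    (by rw [LinearMap.neg_apply, interchange, edgeGenerator_one, neg_zero]) h1
  set w : Equiv.Perm (Fin n) → ℝ := fun η => (f ∘ π) η -
    (∑ r, (f ∘ π) r) / Fintype.card (Equiv.Perm (Fin n)) with hw
  have h3 := interchange_form_ge G (fun g hg => spectralGap_mul_le (symmetricOp_randomWalk G)
    (by rwa [Fintype.card_fin]) (randomWalk_one G) (sum_neg_randomWalk_mul_self_nonneg G) g hg)
    w (sum_sub_mean _)
  rw [h2] at h3
  simp only [Pi.smul_apply, smul_eq_mul, mul_assoc, ← Finset.mul_sum] at h3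
  refine le_of_mul_le_mul_right h3 ?_
  obtain ⟨r, s, hrs⟩ := hf
  obtain ⟨η, rfl⟩ := hπ.1 r
  obtain ⟨θ, rfl⟩ := hπ.1 s
  have : w η ≠ 0 ∨ w θ ≠ 0 := by
    by_contra! hc
    apply hrs
    have e := hc.1.trans hc.2.symm
    simpa [hw] using e
  rcases this with h | h
  · exact Finset.sum_pos' (fun _ _ => mul_self_nonneg _) ⟨η, mem_univ _, mul_self_pos.mpr h⟩
  · exact Finset.sum_pos' (fun _ _ => mul_self_nonneg _) ⟨θ, mem_univ _, mul_self_pos.mpr h⟩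

theorem isSubprocessVia_edgeGenerator {n : ℕ} (G : WeightedGraph n) {S : Type}
    {act : Fin n → Fin n → S → S} {π : Equiv.Perm (Fin n) → S} (hs : Function.Surjective π)
    (h : ∀ x y η, π (η * Equiv.swap x y) = act x y (π η)) :
    IsSubprocessVia (edgeGenerator G act) (interchange G) π := by
  refine ⟨hs, fun f => funext fun η => ?_⟩
  simp only [interchange, edgeGenerator_apply, Function.comp_apply, h]

theorem mapEdges_mapEdges {n : ℕ} (σ τ : Equiv.Perm (Fin n)) (γ : Finset (Sym2 (Fin n))) :
    mapEdges σ (mapEdges τ γ) = mapEdges (σ * τ) γ := by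
  simp only [mapEdges, Finset.image_image, Equiv.Perm.coe_mul, Sym2.map_comp]

theorem mapEdges_one {n : ℕ} (γ : Finset (Sym2 (Fin n))) : mapEdges 1 γ = γ := by
  simp [mapEdges]

theorem mapEdges_swap_involutive {n : ℕ} (x y : Fin n) :
    Function.Involutive (mapEdges (Equiv.swap x y)) := by
  intro γ
  rw [mapEdges_mapEdges, Equiv.swap_mul_self, mapEdges_one]

/-! ### The cycle process -/

theorem mem_standardCycle {n : ℕ} (hn : 4 ≤ n) (a b : Fin n) :
    s(a, b) ∈ standardCycle n ↔ (SimpleGraph.cycleGraph n).Adj a b := by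
  obtain ⟨m, rfl⟩ : ∃ m, n = m + 2 := ⟨n - 2, by omega⟩
  simp only [SimpleGraph.cycleGraph_adj, standardCycle, Finset.mem_image, mem_univ, true_and,
    finRotate_apply, Sym2.eq_iff]
  constructor
  · rintro ⟨i, (⟨rfl, rfl⟩ | ⟨rfl, rfl⟩)⟩
    · right; abel
    · left; abel
  · rintro (h | h)
    · exact ⟨b, Or.inr ⟨rfl, by rw [← h]; abel⟩⟩
    · exact ⟨a, Or.inl ⟨rfl, by rw [← h]; abel⟩⟩

theorem cycleProjection_val {n : ℕ} (hn : 4 ≤ n) (η : Equiv.Perm (Fin n)) :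
    (cycleProjection hn η).1 = mapEdges η⁻¹ (standardCycle n) := by
  rw [mapEdges, standardCycle, Finset.image_image]
  rfl

/-- An isomorphism from γ to the standard cycle graph is itself a preimage, as a map from vertices
to labels. -/
theorem cycleProjection_surjective {n : ℕ} (hn : 4 ≤ n) :
    Function.Surjective (cycleProjection hn) := by
  rintro ⟨γ, h1, ⟨φ⟩⟩
  refine ⟨φ.toEquiv, Subtype.ext ?_⟩
  rw [cycleProjection_val]
  ext e
  induction e using Sym2.ind with
  | _ a b =>
    have h2 : s(a, b) = Sym2.map (φ.toEquiv⁻¹ : Equiv.Perm (Fin n)) s(φ a, φ b) := by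
      rw [Sym2.map_mk]
      exact congrArg₂ (fun x y => s(x, y)) (φ.toEquiv.symm_apply_apply a).symm
        (φ.toEquiv.symm_apply_apply b).symm
    rw [h2, map_mem_mapEdges, mem_standardCycle hn, φ.map_adj_iff, ← h2,
      SimpleGraph.fromEdgeSet_adj, Finset.mem_coe]
    exact ⟨fun h => h.1, fun h => ⟨h, by simpa using h1 _ h⟩⟩

/-- Exchanging 1 and 2 turns the edge 01 into 02, which is a chord of the standard cycle once n ≥ 4.
-/
theorem nontrivial_cycleState {n : ℕ} (hn : 4 ≤ n) : Nontrivial (CycleState n) := by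
  obtain ⟨m, rfl⟩ : ∃ m, n = m + 4 := ⟨n - 4, by omega⟩
  refine ⟨⟨_, isNCycle_standardCycle hn⟩, cycleMove 1 2 ⟨_, isNCycle_standardCycle hn⟩, ?_⟩
  intro h
  have h1 : s((0 : Fin (m + 4)), 2) ∈ mapEdges (Equiv.swap 1 2) (standardCycle (m + 4)) := by
    have : s((0 : Fin (m + 4)), 1) ∈ standardCycle (m + 4) :=
      Finset.mem_image.mpr ⟨0, mem_univ _, by simp⟩
    have h2 := (map_mem_mapEdges (Equiv.swap 1 2) _ _).mpr this
    rwa [Sym2.map_mk, Equiv.swap_apply_left, Equiv.swap_apply_of_ne_of_ne] at h2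
    · simp
    · simp [Fin.ext_iff, Nat.mod_eq_of_lt (show 2 < m + 4 by omega)]
  have h2 : s((0 : Fin (m + 4)), 2) ∉ standardCycle (m + 4) := by
    simp only [standardCycle, Finset.mem_image, mem_univ, true_and, finRotate_apply, Sym2.eq_iff,
      not_exists]
    rintro i (⟨rfl, h⟩ | ⟨rfl, h⟩)
    · simp [Fin.ext_iff, Nat.mod_eq_of_lt (show 2 < m + 4 by omega)] at h
    · have h3 := congrArg Fin.val h
      rw [Fin.val_add] at h3
      simp [Nat.mod_eq_of_lt (show 2 < m + 4 by omega),
        Nat.mod_eq_of_lt (show 3 < m + 4 by omega)] at h3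
  have h3 : standardCycle (m + 4) = mapEdges (Equiv.swap 1 2) (standardCycle (m + 4)) :=
    congrArg Subtype.val h
  exact h2 (h3 ▸ h1)

theorem isSubprocessVia_cycleProcess {n : ℕ} (hn : 4 ≤ n) (G : WeightedGraph n) :
    IsSubprocessVia (cycleProcess G) (interchange G) (cycleProjection hn) := by
  refine isSubprocessVia_edgeGenerator G (cycleProjection_surjective hn) fun x y η => ?_
  apply Subtype.ext
  change _ = mapEdges (Equiv.swap x y) (cycleProjection hn η).1
  -- Since (ητ)⁻¹ = τη⁻¹, right multiplication of the state becomes the vertex exchange on edges.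
  rw [cycleProjection_val, cycleProjection_val, mapEdges_mapEdges, mul_inv_rev,
    Equiv.swap_inv]

theorem spectralGap_cycleProcess_ge {n : ℕ} (hn : 4 ≤ n) (G : WeightedGraph n) :
    spectralGap (cycleProcess G) ≥ spectralGap (randomWalk G) :=
  have := nontrivial_cycleState hn
  spectralGap_ge_of_isSubprocessVia (by omega) G
    (fun x y γ => Subtype.ext (mapEdges_swap_involutive x y γ.1))
    (isSubprocessVia_cycleProcess hn G)

/-! ### The matching process -/

theorem matchingProjection_val {k : ℕ} (η : Equiv.Perm (Fin (2 * k))) :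
    (matchingProjection η).1 =
      mapEdges η⁻¹ (univ.image fun i : Fin k => s(lowLabel i, highLabel i)) := by
  rw [mapEdges, Finset.image_image]
  rfl

theorem labels_bijective (k : ℕ) :
    Function.Bijective (Sum.elim (lowLabel : Fin k → Fin (2 * k)) highLabel) := by
  rw [Fintype.bijective_iff_injective_and_card]
  refine ⟨?_, by simp [two_mul]⟩
  rintro (i | i) (j | j) h <;> have h' := congrArg Fin.val h <;>
    simp only [Sum.elim_inl, Sum.elim_inr, lowLabel, highLabel] at h'
  · exact congrArg Sum.inl (Fin.ext h')
  · omega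
  · omega
  · exact congrArg Sum.inr (Fin.ext (by omega))

/-- The k disjoint edges have 2k distinct endpoints, so a choice of ordered endpoints is a bijection
from the 2k labels to the vertices; its inverse is the required state. -/
theorem matchingProjection_surjective {k : ℕ} :
    Function.Surjective (matchingProjection : Equiv.Perm (Fin (2 * k)) → MatchingState k) := by
  rintro ⟨ζ, h1, h2, h3⟩
  let ε : Fin k ≃ ζ := (ζ.equivFinOfCardEq h2).symm
  have hout : ∀ e : Sym2 (Fin (2 * k)), ∃ u v, e = s(u, v) := fun e =>
    Sym2.ind (fun u v => ⟨u, v, rfl⟩) e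
  choose u v huv using fun i : Fin k => hout (ε i).1
  have hu : ∀ i, u i ∈ (ε i).1 := fun i => by rw [huv i]; exact Sym2.mem_mk_left _ _
  have hv : ∀ i, v i ∈ (ε i).1 := fun i => by rw [huv i]; exact Sym2.mem_mk_right _ _
  have hne : ∀ i, u i ≠ v i := fun i h => h1 _ (ε i).2 (by rw [huv i, h]; simp)
  have hdisj : ∀ i j x, x ∈ (ε i).1 → x ∈ (ε j).1 → i = j := by
    intro i j x hi hj
    by_contra hij
    exact h3 _ (ε i).2 _ (ε j).2 (fun h => hij (ε.injective (Subtype.ext h))) x hi hj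
  have hr : Function.Bijective (Sum.elim u v) := by
    rw [Fintype.bijective_iff_injective_and_card]
    refine ⟨?_, by simp [two_mul]⟩
    rintro (i | i) (j | j) h <;> simp only [Sum.elim_inl, Sum.elim_inr] at h
    · rw [hdisj i j _ (hu i) (h ▸ hu j)]
    · obtain rfl := hdisj i j _ (hu i) (h ▸ hv j)
      exact absurd h (hne i)
    · obtain rfl := hdisj i j _ (hv i) (h ▸ hu j)
      exact absurd h.symm (hne i)
    · rw [hdisj i j _ (hv i) (h ▸ hv j)]
  let q := Equiv.ofBijective _ (labels_bijective k)
  let σ : Equiv.Perm (Fin (2 * k)) := q.symm.trans (Equiv.ofBijective _ hr)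
  have hlow : ∀ i, σ (lowLabel i) = u i := fun i => by
    change Sum.elim u v (q.symm (q (Sum.inl i))) = u i
    rw [q.symm_apply_apply]
    rfl
  have hhigh : ∀ i, σ (highLabel i) = v i := fun i => by
    change Sum.elim u v (q.symm (q (Sum.inr i))) = v i
    rw [q.symm_apply_apply]
    rfl
  refine ⟨σ⁻¹, Subtype.ext ?_⟩
  rw [matchingProjection_val, inv_inv, mapEdges, Finset.image_image]
  ext e
  simp only [Finset.mem_image, mem_univ, true_and, Function.comp_apply, Sym2.map_mk, hlow, hhigh,
    ← huv]
  constructor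
  · rintro ⟨i, rfl⟩
    exact (ε i).2
  · intro he
    exact ⟨ε.symm ⟨e, he⟩, by rw [ε.apply_symm_apply]⟩

/-- Exchanging the partners of the first two low labels creates an edge from the first low label to
the second high label, absent from the standard matching. -/
theorem nontrivial_matchingState {k : ℕ} (hk : 2 ≤ k) : Nontrivial (MatchingState k) := by
  let i : Fin k := ⟨0, by omega⟩
  let j : Fin k := ⟨1, by omega⟩
  refine ⟨matchingProjection 1,
    matchingMove (highLabel i) (highLabel j) (matchingProjection 1), ?_⟩
  intro h
  have h0 : (matchingProjection (1 : Equiv.Perm (Fin (2 * k)))).1 =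
      univ.image fun i : Fin k => s(lowLabel i, highLabel i) := by
    rw [matchingProjection_val, inv_one, mapEdges_one]
  have h1 : s(lowLabel i, highLabel j) ∈ mapEdges (Equiv.swap (highLabel i) (highLabel j))
      (univ.image fun i : Fin k => s(lowLabel i, highLabel i)) := by
    have h2 := (map_mem_mapEdges (Equiv.swap (highLabel i) (highLabel j)) _ _).mpr
      (Finset.mem_image.mpr ⟨i, mem_univ _, rfl⟩ : s(lowLabel i, highLabel i) ∈
        univ.image fun i : Fin k => s(lowLabel i, highLabel i))
    rwa [Sym2.map_mk, Equiv.swap_apply_left, Equiv.swap_apply_of_ne_of_ne] at h2 <;>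
      · simp only [lowLabel, highLabel, ne_eq, Fin.mk.injEq]
        omega
  have h3 : (matchingProjection (1 : Equiv.Perm (Fin (2 * k)))).1 =
      mapEdges (Equiv.swap (highLabel i) (highLabel j)) (matchingProjection 1).1 :=
    congrArg Subtype.val h
  rw [← h0, ← h3, h0] at h1
  obtain ⟨l, -, hl⟩ := Finset.mem_image.mp h1
  rw [Sym2.eq_iff] at hl
  simp only [lowLabel, highLabel, Fin.mk.injEq, i, j] at hl
  omega

theorem isSubprocessVia_matchingProcess {k : ℕ} (G : WeightedGraph (2 * k)) :
    IsSubprocessVia (matchingProcess G) (interchange G) matchingProjection := by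
  refine isSubprocessVia_edgeGenerator G matchingProjection_surjective fun x y η => ?_
  apply Subtype.ext
  change _ = mapEdges (Equiv.swap x y) (matchingProjection η).1
  rw [matchingProjection_val, matchingProjection_val, mapEdges_mapEdges,
    mul_inv_rev, Equiv.swap_inv]

theorem spectralGap_matchingProcess_ge {k : ℕ} (hk : 2 ≤ k) (G : WeightedGraph (2 * k)) :
    spectralGap (matchingProcess G) ≥ spectralGap (randomWalk G) :=
  have := nontrivial_matchingState hk
  spectralGap_ge_of_isSubprocessVia (by omega) G
    (fun x y ζ => Subtype.ext (mapEdges_swap_involutive x y ζ.1))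
    (isSubprocessVia_matchingProcess G)

end AldousGap

theorem mainTheorem7 :
    (∀ (n : ℕ) (hn : 4 ≤ n) (G : AldousGap.WeightedGraph n), G.skeleton.Connected →
      AldousGap.IsSubprocessVia (AldousGap.cycleProcess G) (AldousGap.interchange G)
        (AldousGap.cycleProjection hn) ∧
      AldousGap.spectralGap (AldousGap.cycleProcess G) ≥
        AldousGap.spectralGap (AldousGap.randomWalk G)) ∧
    (∀ (k : ℕ), 2 ≤ k → ∀ (G : AldousGap.WeightedGraph (2 * k)), G.skeleton.Connected →
      AldousGap.IsSubprocessVia (AldousGap.matchingProcess G) (AldousGap.interchange G)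
        AldousGap.matchingProjection ∧
      AldousGap.spectralGap (AldousGap.matchingProcess G) ≥
        AldousGap.spectralGap (AldousGap.randomWalk G)) :=
  ⟨fun _ hn G _ => ⟨AldousGap.isSubprocessVia_cycleProcess hn G,
      AldousGap.spectralGap_cycleProcess_ge hn G⟩,
    fun _ hk G _ => ⟨AldousGap.isSubprocessVia_matchingProcess G,
      AldousGap.spectralGap_matchingProcess_ge hk G⟩⟩
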